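/- Fix the alphabet $\Sigma=\{0,1\}$. For a generator $f:\Sigma^*\to\Sigma$ put $\bar f(x)=\mathrm{append}(x,f(x))$, let $f^{\mathrm{CoT}\text{-}T}=\bar f\circ\dots\circ\bar f$ ($T$ times) and let $f^{\mathrm{e2e}\text{-}T}(x)$ be the last token of $f^{\mathrm{CoT}\text{-}T}(x)$, $T\ge 1$. For a class $\mathcal F\subseteq\Sigma^{\Sigma^*}$, the class $\mathrm{e2e}^T(\mathcal F)=\{f^{\mathrm{e2e}\text{-}T}: f\in\mathcal F\}$ is *CoT-learned* over a domain $X\subseteq\Sigma^*$ by a rule $A$ with sample complexity $m(\varepsilon,\delta)$ if for every distribution $D$ over $X$, every $f_*\in\mathcal F$ and all $0<\varepsilon,\delta<1$, with probability at least $1-\delta$ over i.i.d. $x_1,\dots,x_m\sim D$, $m=m(\varepsilon,\delta)$, and with $S=(f_*^{\mathrm{CoT}\text{-}T}(x_1),\dots,f_*^{\mathrm{CoT}\text{-}T}(x_m))$, we have $\Pr_{x\sim D}\big(A(S)(x)\neq f_*^{\mathrm{e2e}\text{-}T}(x)\big)\le\varepsilon$. Algorithms are deterministic programs in a step-counting multi-stack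 machine model (polynomially equivalent to multi-tape Turing machines). They return functions through descriptions: a representation scheme $\rho$ assigns to every $d\in\mathbb N$ and every finite string $w$ a generator $\rho_d(w):\Sigma^*\to\Sigma$. Let $(\mathcal F_d)_{d\in\mathbb N}$ be a family of classes $\mathcal F_d\subseteq\Sigma^{\Sigma^*}$ and $\rho$ any representation scheme such that: (i) ($\mathrm{Cons}_{\mathcal F_d}$ is tractable) there is an algorithm that, given $d$ and labelled examples $(u_i,v_i)_{i}$ in $\Sigma^*\times\Sigma$ with which some member of $\mathcal F_d$ is consistent, returns some $w$ such that $\rho_d(w)\in\mathcal F_d$ and $\rho_d(w)(u_i)=v_i$ for all $i$, in time polynomial in the length of the examples and in $d$; (ii) $\mathrm{VCdim}(\mathcal F_d)$ is finite and bounded by a polynomial in $d$. Then $\mathrm{e2e}^T(\mathcal F_d)$ is CoT-learnable in time $\mathrm{poly}(n,d,T,\varepsilon^{-1},\log\delta^{-1})$. That is, there are one algorithm, which on $(S,d,T)$ returns a string $w=A_{d,T}(S)$, standing for the predictor $\rho_d(w)^{\mathrm{e2e}\text{-}T}$, a function $m_{d,T}(\varepsilon,\delta)$ and a polynomial $p$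 such that, for all $d\in\mathbb N$ and $T\ge1$: the rule CoT-learns $\mathrm{e2e}^T(\mathcal F_d)$ over every domain $X\subseteq\Sigma^*$ with sample complexity $m_{d,T}$; and for all $n$ and all $0<\varepsilon,\delta<1$ we have $m_{d,T}(\varepsilon,\delta)\le p(n,d,T,\varepsilon^{-1},\log\delta^{-1})$, and on every sample $S$ of size $m_{d,T}(\varepsilon,\delta)$ generated by a member of $\mathcal F_d$ from inputs of length at most $n$, $\rho_d(w)\in\mathcal F_d$ and the algorithm halts within $p(n,d,T,\varepsilon^{-1},\log\delta^{-1})$ steps. If moreover $\rho_d(w)(u)$ can be computed from $(w,d,u)$, for $\rho_d(w)\in\mathcal F_d$, in time polynomial in $|w|$, $d$ and $|u|$, then the learned predictor can be computed, by one algorithm that on inputs $x$ of length at most $n$ is given $(w,d,T,x)$, in time polynomial in $n,d,T,\varepsilon^{-1},\log\delta^{-1}$ as well. -/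

import Mathlib

open MeasureTheory

namespace CoTLearning

/-! ### Autoregressive generation over the binary alphabet -/

/-- Strings over the token alphabet `{0,1}`. -/
abbrev Str := List Bool

/-- A next-token generator `f : {0,1}* → {0,1}`. -/
abbrev Gen := Str → Bool

/-- Apply and append: `x ↦ append(x, f(x))`. -/
def applyAppend (f : Gen) (x : Str) : Str := x ++ [f x]

/-- The `T`-step Chain-of-Thought of `x`: apply-and-append iterated `T` times. -/
def cot (f : Gen) (T : ℕ) (x : Str) : Str := (applyAppend f)^[T] x

/-- The end-to-end map: the last token of the `T`-step Chain-of-Thought.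
It is only used for `T ≥ 1`, where the string is non-empty and the default is irrelevant. -/
def e2e (f : Gen) (T : ℕ) (x : Str) : Bool := (cot f T x).getLastD false

/-! ### VC dimension -/

/-- `H` shatters the finite set `s` of points: every labelling of `s` is realized by `H`. -/
def Shatters (H : Set Gen) (s : Finset Str) : Prop :=
  ∀ g : Str → Bool, ∃ h ∈ H, ∀ x ∈ s, h x = g x

/-- The VC dimension: the supremum of the sizes of the shattered sets. -/
noncomputable def vcDim (H : Set Gen) : ℕ∞ :=
  ⨆ (s : Finset Str) (_ : Shatters H s), (s.card : ℕ∞)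

/-! ### Realizable Chain-of-Thought learnability -/

/-- Strings form a countable set; every set of strings is measurable. -/
instance : MeasurableSpace Str := ⊤

/-- The Chain-of-Thought training set `(cot f T x₁, …, cot f T xₘ)`. -/
def cotSample (f : Gen) (T : ℕ) (xs : List Str) : List Str := xs.map (cot f T)

/-- The learning rule `A`, with sample complexity `m`, learns the `T`-step end-to-end class of `F`
over the domain `X` from Chain-of-Thought data: for every distribution `D` over `X`, every `f ∈ F`
and all `0 < ε, δ < 1`, with probability at least `1 - δ` over `m ε δ` independent draws from `D`,
the predictor `A S` has population error at most `ε`. -/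
def CoTLearns (F : Set Gen) (T : ℕ) (X : Set Str) (A : List Str → Str → Bool)
    (m : ℝ → ℝ → ℕ) : Prop :=
  ∀ D : Measure Str, IsProbabilityMeasure D → D Xᶜ = 0 →
    ∀ f ∈ F, ∀ ε δ : ℝ, 0 < ε → ε < 1 → 0 < δ → δ < 1 →
      ENNReal.ofReal (1 - δ) ≤
        Measure.pi (fun _ : Fin (m ε δ) => D)
          {xs | D {x | A (cotSample f T (List.ofFn xs)) x ≠ e2e f T x} ≤ ENNReal.ofReal ε}

/-! ### Machine model

Structured programs over finitely many stacks. Every elementary operation (push, pop, test of the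
top of a stack) takes one step. A tape is a pair of stacks, so multi-tape Turing machines and these
programs simulate each other with constant-factor overhead per step. -/

/-- The stack alphabet: the two bits and a separator. -/
inductive Symb : Type
  | bit (b : Bool)
  | sep

/-- A memory: the contents of the stacks, the top of a stack being the head of the list. -/
abbrev Store := ℕ → List Symb

/-- Programs. A test compares the top of stack `r` with `o`, where `o = none` tests for
emptiness. -/
inductive Prog : Type
  | skip
  | push (r : ℕ) (a : Symb)
  | pop (r : ℕ)
  | seq (p q : Prog)
  | cond (r : ℕ) (o : Option Symb) (p q : Prog)
  | loopUntil (r : ℕ) (o : Option Symb) (p : Prog)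

/-- `Run p s t s'`: started in memory `s`, the program `p` halts after exactly `t` steps in
memory `s'`. -/
inductive Run : Prog → Store → ℕ → Store → Prop
  | skip (s : Store) : Run Prog.skip s 1 s
  | push (r : ℕ) (a : Symb) (s : Store) :
      Run (Prog.push r a) s 1 (Function.update s r (a :: s r))
  | pop (r : ℕ) (s : Store) :
      Run (Prog.pop r) s 1 (Function.update s r (s r).tail)
  | seq {p q : Prog} {s s' s'' : Store} {t t' : ℕ} :
      Run p s t s' → Run q s' t' s'' → Run (Prog.seq p q) s (t + t') s''
  | condThen {r : ℕ} {o : Option Symb} {p q : Prog} {s s' : Store} {t : ℕ} :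
      (s r).head? = o → Run p s t s' → Run (Prog.cond r o p q) s (t + 1) s'
  | condElse {r : ℕ} {o : Option Symb} {p q : Prog} {s s' : Store} {t : ℕ} :
      (s r).head? ≠ o → Run q s t s' → Run (Prog.cond r o p q) s (t + 1) s'
  | loopDone {r : ℕ} {o : Option Symb} {p : Prog} {s : Store} :
      (s r).head? = o → Run (Prog.loopUntil r o p) s 1 s
  | loopStep {r : ℕ} {o : Option Symb} {p : Prog} {s s' s'' : Store} {t t' : ℕ} :
      (s r).head? ≠ o → Run p s t s' → Run (Prog.loopUntil r o p) s' t' s'' →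
        Run (Prog.loopUntil r o p) s (t + t' + 1) s''

/-- The initial memory: the inputs on stacks `0, 1, 2, …`, all other stacks empty. -/
def load (inputs : List (List Symb)) : Store := fun r => inputs.getD r []

/-- On the given inputs, `p` halts within `B` steps with `out` on stack `0`. -/
def Prog.Outputs (p : Prog) (inputs : List (List Symb)) (out : List Symb) (B : ℝ) : Prop :=
  ∃ (t : ℕ) (s : Store), Run p (load inputs) t s ∧ s 0 = out ∧ (t : ℝ) ≤ B

/-! ### Encodings -/

/-- A string of tokens as a string of stack symbols. -/
def encStr (x : Str) : List Symb := x.map Symb.bit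

/-- A number in unary (all running times below are polynomial in the value of the number). -/
def encNat (k : ℕ) : List Symb := List.replicate k (Symb.bit true)

/-- A list of strings, each followed by a separator. -/
def encStrs (S : List Str) : List Symb := S.flatMap fun z => encStr z ++ [Symb.sep]

/-- A list of labelled strings `(u, v)`, each written as `u`, a separator, the bit `v`. -/
def encLabelled (S : List (Str × Bool)) : List Symb :=
  S.flatMap fun e => encStr e.1 ++ [Symb.sep, Symb.bit e.2]

/-! ### Tractability

An algorithm returns a function by returning a description of it. A representation scheme `ρ` says
which generator `ρ d w` the string `w` describes at size parameter `d`. -/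

/-- The consistency problem for `F d` can be solved, with descriptions in the scheme `ρ`, in time
polynomial in the length of the input and `d`: given `d` and a labelled sample that some member of
`F d` fits, the program returns a description of a member of `F d` that fits the sample. -/
def ConsInPolyTime (F : ℕ → Set Gen) (ρ : ℕ → List Symb → Gen) : Prop :=
  ∃ (cons : Prog) (p : MvPolynomial (Fin 2) ℝ),
    ∀ (d : ℕ) (S : List (Str × Bool)), (∃ f ∈ F d, ∀ e ∈ S, f e.1 = e.2) →
      ∃ w : List Symb, ρ d w ∈ F d ∧ (∀ e ∈ S, ρ d w e.1 = e.2) ∧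
        cons.Outputs [encLabelled S, encNat d] w
          (MvPolynomial.eval ![((encLabelled S).length : ℝ), (d : ℝ)] p)

/-- Described members of `F d` can be evaluated in time polynomial in the length of the
description, `d` and the length of the argument. -/
def EvalInPolyTime (F : ℕ → Set Gen) (ρ : ℕ → List Symb → Gen) : Prop :=
  ∃ (ev : Prog) (p : MvPolynomial (Fin 3) ℝ),
    ∀ (d : ℕ) (w : List Symb), ρ d w ∈ F d → ∀ u : Str,
      ev.Outputs [w, encNat d, encStr u] [Symb.bit (ρ d w u)]
        (MvPolynomial.eval ![(w.length : ℝ), (d : ℝ), (u.length : ℝ)] p)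

/-- The VC dimension of `F d` is finite and bounded by a polynomial in `d`. -/
def VCPolyBounded (F : ℕ → Set Gen) : Prop :=
  ∃ p : Polynomial ℝ, ∀ d : ℕ, ∃ k : ℕ, vcDim (F d) = k ∧ (k : ℝ) ≤ p.eval (d : ℝ)

/-- The value of a polynomial at `(n, d, T, 1/ε, log (1/δ))`. -/
noncomputable def bound (p : MvPolynomial (Fin 5) ℝ) (n d T : ℕ) (ε δ : ℝ) : ℝ :=
  MvPolynomial.eval ![(n : ℝ), (d : ℝ), (T : ℝ), 1 / ε, Real.log (1 / δ)] p

/-- The `T`-step end-to-end class of `F d` is Chain-of-Thought learnable in time polynomial in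
`n, d, T, 1/ε, log (1/δ)`. One program `train` serves all parameters; it is given the sample, `d`
and `T`, and returns a description `A d T S` of a member of `F d`, the learned predictor being the
`T`-step end-to-end map of the described generator.
* The rule learns over every domain, with a sample complexity that does not depend on `n`.
* The sample complexity is polynomially bounded.
* On every sample of the prescribed size with inputs of length at most `n`, labelled by a member
  of `F d`, the rule is proper and `train` computes it in polynomial time.
* If described members of `F d` can be evaluated in polynomial time, then so can the learned
  predictor, on inputs of length at most `n`. -/
def CoTLearnableInPolyTime (F : ℕ → Set Gen) (ρ : ℕ → List Symb → Gen) : Prop :=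
  ∃ (train : Prog) (A : ℕ → ℕ → List Str → List Symb) (m : ℕ → ℕ → ℝ → ℝ → ℕ)
    (p : MvPolynomial (Fin 5) ℝ),
    (∀ d T : ℕ, 0 < T → ∀ X : Set Str,
      CoTLearns (F d) T X (fun S => e2e (ρ d (A d T S)) T) (m d T)) ∧
    (∀ (n d T : ℕ) (ε δ : ℝ), 0 < T → 0 < ε → ε < 1 → 0 < δ → δ < 1 →
      (m d T ε δ : ℝ) ≤ bound p n d T ε δ) ∧
    (∀ (n d T : ℕ) (ε δ : ℝ), 0 < T → 0 < ε → ε < 1 → 0 < δ → δ < 1 →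
      ∀ f ∈ F d, ∀ xs : List Str, xs.length = m d T ε δ → (∀ x ∈ xs, x.length ≤ n) →
        ρ d (A d T (cotSample f T xs)) ∈ F d ∧
        train.Outputs [encStrs (cotSample f T xs), encNat d, encNat T]
          (A d T (cotSample f T xs)) (bound p n d T ε δ)) ∧
    (EvalInPolyTime F ρ →
      ∃ (predict : Prog) (q : MvPolynomial (Fin 5) ℝ),
        ∀ (n d T : ℕ) (ε δ : ℝ), 0 < T → 0 < ε → ε < 1 → 0 < δ → δ < 1 →
          ∀ f ∈ F d, ∀ xs : List Str, xs.length = m d T ε δ → (∀ x ∈ xs, x.length ≤ n) →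
            ∀ x : Str, x.length ≤ n →
              predict.Outputs [A d T (cotSample f T xs), encNat d, encNat T, encStr x]
                [Symb.bit (e2e (ρ d (A d T (cotSample f T xs))) T x)] (bound q n d T ε δ))

end CoTLearning

open CoTLearning

/-!
A generator that agrees with `f` on all Chain-of-Thought prefixes of a sample produces the same
Chains-of-Thought, so one call of the consistency oracle on the `m * T` next-token examples of a
sample of size `m` returns a generator that is consistent with the sample. Two generators have
different Chains-of-Thought on `x` if and only if they differ at one of the `T` prefixes that the
first one passes through. By the Sauer–Shelah lemma the disagreement sets of a fixed target
therefore cut at most `(2 * m * T + 1) ^ k` patterns from `2 * m` inputs, where `k` is the VC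
dimension, and a double-sample argument shows that every consistent rule learns once this number is
small against `exp (ε * m / 4)`. Besides running the given programs, training and prediction only
cut, move and copy strings.
-/

namespace CoTLearning

/-! ### The Sauer–Shelah bound -/

theorem sum_range_choose_le_pow (n k : ℕ) :
    ∑ i ∈ Finset.range (k + 1), n.choose i ≤ (n + 1) ^ k := by
  induction k with
  | zero => simp
  | succ k ih =>
    calc ∑ i ∈ Finset.range (k + 1 + 1), n.choose i
        = ∑ i ∈ Finset.range (k + 1), n.choose i + n.choose (k + 1) := Finset.sum_range_succ _ _
      _ ≤ (n + 1) ^ k + n ^ (k + 1) := add_le_add ih (Nat.choose_le_pow _ _)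
      _ = (n + 1) ^ k + n * n ^ k := by ring
      _ ≤ (n + 1) ^ k + n * (n + 1) ^ k := by gcongr; exact n.le_succ
      _ = (n + 1) ^ (k + 1) := by ring

theorem Shatters.card_le {H : Set Gen} {k : ℕ} (hk : vcDim H = k) {s : Finset Str}
    (hs : Shatters H s) : s.card ≤ k := by
  have h : (s.card : ℕ∞) ≤ vcDim H := le_iSup₂_of_le s hs le_rfl
  exact_mod_cast hk ▸ h

section Sauer

variable {H : Set Gen} {k : ℕ} {κ : Type*} [Fintype κ] {u : κ → Str}

open Classical in
/-- The sets of indices on which the members of `H` output `1` along the points `u`. Indexing the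
points, possibly with repetitions, makes this a set family over a finite type. -/
noncomputable def positiveSets (H : Set Gen) (u : κ → Str) : Finset (Finset κ) :=
  {A | ∃ h ∈ H, ∀ p, p ∈ A ↔ h (u p) = true}

open Classical in
theorem exists_mem_of_shatters_positiveSets {s t : Finset κ} (hs : (positiveSets H u).Shatters s)
    (ht : t ⊆ s) : ∃ h ∈ H, ∀ p ∈ s, h (u p) = true ↔ p ∈ t := by
  obtain ⟨A, hA, rfl⟩ := hs ht
  obtain ⟨h, hH, hAh⟩ := (Finset.mem_filter.1 hA).2
  exact ⟨h, hH, fun p hp => by simp [← hAh, hp]⟩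

open Classical in
theorem vcDim_positiveSets_le (hk : vcDim H = k) : (positiveSets H u).vcDim ≤ k := by
  refine Finset.sup_le fun s hs => ?_
  have hs : (positiveSets H u).Shatters s := Finset.mem_shatterer.1 hs
  have hinj : Set.InjOn u s := by
    intro p hp q hq hpq
    obtain ⟨h, -, hh⟩ := exists_mem_of_shatters_positiveSets hs (Finset.singleton_subset_iff.2 hp)
    have hq' := (hh q hq).1 (hpq ▸ (hh p hp).2 (Finset.mem_singleton_self p))
    exact (Finset.mem_singleton.1 hq').symm
  have hshatters : Shatters H (s.image u) := by
    intro g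
    obtain ⟨h, hH, hh⟩ := exists_mem_of_shatters_positiveSets hs
      (Finset.filter_subset (fun p => g (u p) = true) s)
    refine ⟨h, hH, Finset.forall_mem_image.2 fun p hp => Bool.eq_iff_iff.2 ?_⟩
    simp [hh p hp, Finset.mem_coe.1 hp]
  exact Finset.card_image_of_injOn hinj ▸ hshatters.card_le hk

open Classical in
theorem ncard_image_comp_le_pow (hk : vcDim H = k) (u : κ → Str) :
    ((· ∘ u) '' H).ncard ≤ (Fintype.card κ + 1) ^ k := by
  have hcover : (· ∘ u) '' H ⊆ (positiveSets H u).image fun A p => decide (p ∈ A) := by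
    rintro _ ⟨h, hH, rfl⟩
    refine Finset.mem_coe.2 (Finset.mem_image.2
      ⟨Finset.univ.filter fun p => h (u p) = true, ?_, ?_⟩)
    · exact Finset.mem_filter.2 ⟨Finset.mem_univ _, h, hH, by simp⟩
    · ext p; simp
  calc ((· ∘ u) '' H).ncard
      ≤ ((positiveSets H u).image fun A p => decide (p ∈ A)).card :=
        (Set.ncard_le_ncard hcover (Finset.finite_toSet _)).trans_eq (Set.ncard_coe_finset _)
    _ ≤ (positiveSets H u).card := Finset.card_image_le
    _ ≤ (positiveSets H u).shatterer.card := Finset.card_le_card_shatterer _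
    _ ≤ ∑ i ∈ Finset.Iic (positiveSets H u).vcDim, (Fintype.card κ).choose i :=
        Finset.card_shatterer_le_sum_vcDim
    _ ≤ ∑ i ∈ Finset.range (k + 1), (Fintype.card κ).choose i :=
        Finset.sum_le_sum_of_subset fun i hi => by
          have := vcDim_positiveSets_le (u := u) hk
          simp only [Finset.mem_Iic, Finset.mem_range] at hi ⊢
          omega
    _ ≤ (Fintype.card κ + 1) ^ k := sum_range_choose_le_pow _ _

end Sauer

/-! ### Sets of large measure are hit: symmetrization with a ghost sample -/

section Symmetrization

variable {Ω ι : Type*} [Fintype ι]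

open Classical in
/-- The number of entries of a sample that lie in `E`. -/
noncomputable def hits (E : Set Ω) (x : ι → Ω) : ℕ :=
  (Finset.univ.filter fun i => x i ∈ E).card

open Classical in
theorem prod_half_eq_half_pow_hits (E : Set Ω) (x : ι → Ω) :
    ∏ i, (if x i ∈ E then 1 / 2 else 1 : ℝ) = (1 / 2) ^ hits E x := by
  simp [hits, Finset.prod_ite]

open Classical in
theorem integral_half_pow_hits [MeasurableSpace Ω] (D : Measure Ω) [IsProbabilityMeasure D]
    {E : Set Ω} (hE : MeasurableSet E) :
    ∫ x, (1 / 2 : ℝ) ^ hits E x ∂(Measure.pi fun _ : ι => D) =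
      (1 - D.real E / 2) ^ Fintype.card ι := by
  have hindicator : (fun y => if y ∈ E then 1 / 2 else 1 : Ω → ℝ) =
      fun y => 1 - E.indicator (fun _ => 1 / 2) y := by
    funext y
    by_cases hy : y ∈ E <;> norm_num [hy]
  have hint : ∫ y, (if y ∈ E then 1 / 2 else 1 : ℝ) ∂D = 1 - D.real E / 2 := by
    rw [hindicator, integral_sub (integrable_const _) ((integrable_const _).indicator hE),
      integral_indicator_const _ hE]
    simp [div_eq_mul_inv]
  simp_rw [← prod_half_eq_half_pow_hits, ← hint]
  exact integral_fintype_prod_eq_pow (fun y => if y ∈ E then 1 / 2 else 1 : Ω → ℝ)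

theorem measureReal_hits_lt_le [MeasurableSpace Ω] (D : Measure Ω) [IsProbabilityMeasure D]
    {E : Set Ω} (hE : MeasurableSet E) (a : ℕ) :
    (Measure.pi fun _ : ι => D).real {x | hits E x < a} ≤
      2 ^ a * (1 - D.real E / 2) ^ Fintype.card ι := by
  classical
  have hintegrable : Integrable (fun x => (1 / 2 : ℝ) ^ hits E x) (Measure.pi fun _ : ι => D) := by
    simp_rw [← prod_half_eq_half_pow_hits]
    refine Integrable.fintype_prod (f := fun _ y => if y ∈ E then 1 / 2 else 1) fun _ => ?_
    refine Integrable.of_bound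
      (Measurable.ite hE measurable_const measurable_const).aestronglyMeasurable 1
      (.of_forall fun y => ?_)
    split_ifs <;> norm_num
  have hmarkov := mul_meas_ge_le_integral_of_nonneg
    (.of_forall fun x => by positivity) hintegrable ((1 / 2 : ℝ) ^ a)
  rw [integral_half_pow_hits D hE] at hmarkov
  have hsub : {x : ι → Ω | hits E x < a} ⊆ {x | (1 / 2 : ℝ) ^ a ≤ (1 / 2) ^ hits E x} :=
    fun x hx => pow_le_pow_of_le_one (M₀ := ℝ) (by norm_num) (by norm_num) (le_of_lt hx)
  calc (Measure.pi fun _ : ι => D).real {x | hits E x < a}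
      ≤ (Measure.pi fun _ : ι => D).real {x | (1 / 2 : ℝ) ^ a ≤ (1 / 2) ^ hits E x} :=
        measureReal_mono hsub
    _ = 2 ^ a * ((1 / 2) ^ a *
          (Measure.pi fun _ : ι => D).real {x | (1 / 2 : ℝ) ^ a ≤ (1 / 2) ^ hits E x}) := by
        rw [← mul_assoc, ← mul_pow]; norm_num
    _ ≤ 2 ^ a * (1 - D.real E / 2) ^ Fintype.card ι := by gcongr

open Classical in
/-- A uniformly random swap weighs each `σ` by the product of independent factors: `0` if `E` is
met on the sample, `2` if it is met on the ghost only, `1` otherwise. Each factor has mean at most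
`1`. -/
theorem card_swaps_le (E : Set (ι × Bool)) (a : ℕ) :
    (Finset.univ.filter fun σ : ι → Bool => (∀ i, (i, σ i) ∉ E) ∧
      a ≤ hits E fun i => (i, !σ i)).card * 2 ^ a ≤ 2 ^ Fintype.card ι := by
  let w (i : ι) (b : Bool) : ℕ := if (i, b) ∈ E then 0 else if (i, !b) ∈ E then 2 else 1
  rw [← smul_eq_mul]
  calc _ ≤ ∑ σ : ι → Bool with (∀ i, (i, σ i) ∉ E) ∧ a ≤ hits E fun i => (i, !σ i),
          ∏ i, w i (σ i) := by
        refine Finset.card_nsmul_le_sum _ _ _ fun σ hσ => ?_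
        obtain ⟨hmiss, hhits⟩ := (Finset.mem_filter.1 hσ).2
        have hweight : ∏ i, w i (σ i) = 2 ^ hits E fun i => (i, !σ i) := by
          simp [w, hmiss, hits, Finset.prod_ite]
        rw [hweight]
        exact Nat.pow_le_pow_right two_pos hhits
    _ ≤ ∑ σ : ι → Bool, ∏ i, w i (σ i) := Finset.sum_le_sum_of_subset (Finset.filter_subset _ _)
    _ = ∏ i, ∑ b, w i b := by rw [Finset.prod_univ_sum, Fintype.piFinset_univ]
    _ ≤ ∏ _i : ι, 2 := Finset.prod_le_prod' fun i _ => by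
        simp only [w, Fintype.sum_bool, Bool.not_true, Bool.not_false]
        split_ifs <;> simp
    _ = 2 ^ Fintype.card ι := by simp

open Classical in
theorem card_mul_measureReal_le {S X : Type*} [Fintype S] [MeasurableSpace X] {ν : Measure X}
    [IsProbabilityMeasure ν] {φ : S → X → X} (hφ : ∀ s, MeasurePreserving (φ s) ν ν) {Q : Set X}
    (hQ : MeasurableSet Q) {c : ℝ}
    (hc : ∀ x, ((Finset.univ.filter fun s => φ s x ∈ Q).card : ℝ) ≤ c) :
    Fintype.card S * ν.real Q ≤ c := by
  have hpre (s : S) : MeasurableSet (φ s ⁻¹' Q) := (hφ s).measurable hQ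
  have hint (s : S) : Integrable ((φ s ⁻¹' Q).indicator (1 : X → ℝ)) ν :=
    (integrable_const 1).indicator (hpre s)
  calc Fintype.card S * ν.real Q
      = ∑ s, ν.real (φ s ⁻¹' Q) := by
        simp [(hφ _).measureReal_preimage hQ.nullMeasurableSet]
    _ = ∑ s, ∫ x, (φ s ⁻¹' Q).indicator 1 x ∂ν := by simp_rw [integral_indicator_one (hpre _)]
    _ = ∫ x, ∑ s, (φ s ⁻¹' Q).indicator 1 x ∂ν := (integral_finsetSum _ fun s _ => hint s).symm
    _ ≤ ∫ _, c ∂ν := by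
        refine integral_mono (integrable_finsetSum _ fun s _ => hint s) (integrable_const c)
          fun x => ?_
        simpa [Set.indicator_apply] using hc x
    _ = c := by simp

variable {𝓔 : Set (Set Ω)} {a : ℕ}

/-- The event of a sample paired with a ghost sample: some set of `𝓔` avoids the sample and is hit
at least `a` times by the ghost. -/
def missedThenHit (𝓔 : Set (Set Ω)) (a : ℕ) : Set (ι → Ω × Ω) :=
  {z | ∃ E ∈ 𝓔, (∀ i, (z i).1 ∉ E) ∧ a ≤ hits E fun i => (z i).2}

open Classical in
theorem card_swaps_missedThenHit_le {G : ℕ}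
    (hG : ∀ y : ι × Bool → Ω, ((y ⁻¹' ·) '' 𝓔).ncard ≤ G) (z : ι → Ω × Ω) :
    (Finset.univ.filter fun σ : ι → Bool =>
      (fun i => if σ i then (z i).swap else z i) ∈ missedThenHit 𝓔 a).card * 2 ^ a ≤
        G * 2 ^ Fintype.card ι := by
  let y (p : ι × Bool) : Ω := if p.2 then (z p.1).2 else (z p.1).1
  let traces : Finset (Set (ι × Bool)) := ((y ⁻¹' ·) '' 𝓔).toFinite.toFinset
  let N (E : Set (ι × Bool)) : Finset (ι → Bool) :=
    {σ | (∀ i, (i, σ i) ∉ E) ∧ a ≤ hits E fun i => (i, !σ i)}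
  have htraces : traces.card ≤ G := (Set.ncard_eq_toFinset_card _).symm.trans_le (hG y)
  have hfst (σ : ι → Bool) (i : ι) : (if σ i then (z i).swap else z i).1 = y (i, σ i) := by
    cases h : σ i <;> simp [y]
  have hsnd (σ : ι → Bool) (i : ι) : (if σ i then (z i).swap else z i).2 = y (i, !σ i) := by
    cases h : σ i <;> simp [y]
  have hcover : (Finset.univ.filter fun σ : ι → Bool =>
      (fun i => if σ i then (z i).swap else z i) ∈ missedThenHit 𝓔 a) ⊆ traces.biUnion N := by
    intro σ hσ
    obtain ⟨E, hE, hmiss, hhits⟩ := (Finset.mem_filter.1 hσ).2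
    refine Finset.mem_biUnion.2 ⟨y ⁻¹' E, by simpa [traces] using ⟨E, hE, rfl⟩,
      Finset.mem_filter.2 ⟨Finset.mem_univ _, fun i => ?_, ?_⟩⟩
    · simpa only [hfst, Set.mem_preimage] using hmiss i
    · simpa only [hits, hsnd, Set.mem_preimage] using hhits
  calc _ ≤ (∑ E ∈ traces, (N E).card) * 2 ^ a :=
        Nat.mul_le_mul_right _ ((Finset.card_le_card hcover).trans Finset.card_biUnion_le)
    _ = ∑ E ∈ traces, (N E).card * 2 ^ a := Finset.sum_mul _ _ _
    _ ≤ ∑ _E ∈ traces, 2 ^ Fintype.card ι := Finset.sum_le_sum fun E _ => card_swaps_le E a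
    _ = traces.card * 2 ^ Fintype.card ι := by simp
    _ ≤ G * 2 ^ Fintype.card ι := Nat.mul_le_mul_right _ htraces

variable [MeasurableSpace Ω] [Countable Ω] [MeasurableSingletonClass Ω] (D : Measure Ω)
  [IsProbabilityMeasure D]

theorem half_le_measureReal_hits {E : Set Ω} {ε : ℝ} (hE : ε < D.real E)
    (ha : a + 1 ≤ ε * Fintype.card ι / 2) :
    1 / 2 ≤ (Measure.pi fun _ : ι => D).real {y | a ≤ hits E y} := by
  have hnonneg : 0 ≤ 1 - D.real E / 2 := by linarith [measureReal_le_one (μ := D) (s := E)]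
  have hbase : 1 - D.real E / 2 ≤ Real.exp (-(ε / 2)) := by
    linarith [Real.add_one_le_exp (-(ε / 2))]
  have htail : 2 ^ a * (1 - D.real E / 2) ^ Fintype.card ι ≤ 1 / 2 :=
    calc 2 ^ a * (1 - D.real E / 2) ^ Fintype.card ι
        = 2 ^ (a + 1) * (1 - D.real E / 2) ^ Fintype.card ι / 2 := by ring
      _ ≤ Real.exp 1 ^ (a + 1) * Real.exp (-(ε / 2)) ^ Fintype.card ι / 2 := by
          gcongr
          linarith [Real.add_one_le_exp 1]
      _ = Real.exp (a + 1 - ε * Fintype.card ι / 2) / 2 := by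
          rw [← Real.exp_nat_mul, ← Real.exp_nat_mul, ← Real.exp_add]
          congr 2; push_cast; ring
      _ ≤ 1 / 2 := by gcongr; exact Real.exp_le_one_iff.2 (by linarith)
  have hcompl : {y : ι → Ω | a ≤ hits E y} = {y | hits E y < a}ᶜ := by ext; simp
  rw [hcompl, probReal_compl_eq_one_sub .of_discrete]
  linarith [measureReal_hits_lt_le (ι := ι) D (MeasurableSet.of_discrete (s := E)) a]

theorem half_mul_measureReal_missed_le {ε : ℝ} (hhits : ∀ E, ε < D.real E →
      1 / 2 ≤ (Measure.pi fun _ : ι => D).real {y | a ≤ hits E y}) :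
    1 / 2 * (Measure.pi fun _ : ι => D).real {x | ∃ E ∈ 𝓔, ε < D.real E ∧ ∀ i, x i ∉ E} ≤
      (Measure.pi fun _ : ι => D.prod D).real (missedThenHit 𝓔 a) := by
  set μ := Measure.pi fun _ : ι => D
  set B := {x : ι → Ω | ∃ E ∈ 𝓔, ε < D.real E ∧ ∀ i, x i ∉ E}
  let Q : Set ((ι → Ω) × (ι → Ω)) := {p | ∃ E ∈ 𝓔, (∀ i, p.1 i ∉ E) ∧ a ≤ hits E p.2}
  have hQ : MeasurableSet Q := .of_discrete
  have hBQ : ENNReal.ofReal (1 / 2) * μ B ≤ (μ.prod μ) Q := by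
    rw [Measure.prod_apply hQ, ← setLIntegral_const]
    refine (setLIntegral_mono' .of_discrete ?_).trans (setLIntegral_le_lintegral B _)
    rintro x ⟨E, hE, hεE, hx⟩
    calc ENNReal.ofReal (1 / 2) ≤ ENNReal.ofReal (μ.real {y | a ≤ hits E y}) :=
          ENNReal.ofReal_le_ofReal (hhits E hεE)
      _ = μ {y | a ≤ hits E y} := ofReal_measureReal
      _ ≤ μ (Prod.mk x ⁻¹' Q) := measure_mono fun y hy => ⟨E, hE, hx, hy⟩
  have hpair : (Measure.pi fun _ : ι => D.prod D) (missedThenHit 𝓔 a) = (μ.prod μ) Q :=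
    (measurePreserving_arrowProdEquivProdArrow Ω Ω ι (fun _ => D) fun _ => D).measure_preimage
      hQ.nullMeasurableSet
  rw [← hpair] at hBQ
  have := ENNReal.toReal_mono (by finiteness) hBQ
  simpa [Measure.real] using this

theorem measureReal_missedThenHit_le {G : ℕ}
    (hG : ∀ y : ι × Bool → Ω, ((y ⁻¹' ·) '' 𝓔).ncard ≤ G) :
    (Measure.pi fun _ : ι => D.prod D).real (missedThenHit 𝓔 a) ≤ G / 2 ^ a := by
  classical
  have hswap (σ : ι → Bool) : MeasurePreserving
      (fun (z : ι → Ω × Ω) i => if σ i then (z i).swap else z i)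
      (Measure.pi fun _ => D.prod D) (Measure.pi fun _ => D.prod D) :=
    measurePreserving_pi (fun _ => D.prod D) (fun _ => D.prod D)
      (f := fun i p => if σ i then p.swap else p) fun i => by
        cases σ i
        · exact MeasurePreserving.id (D.prod D)
        · exact Measure.measurePreserving_swap
  have hmean := card_mul_measureReal_le hswap (Q := missedThenHit 𝓔 a) .of_discrete
    (c := G * 2 ^ Fintype.card ι / 2 ^ a) fun z => by
      rw [le_div_iff₀ (by positivity)]
      exact_mod_cast card_swaps_missedThenHit_le hG z
  rw [Fintype.card_fun, Fintype.card_bool, mul_comm, mul_div_right_comm] at hmean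
  exact le_of_mul_le_mul_right (mod_cast hmean) (by positivity : (0 : ℝ) < 2 ^ Fintype.card ι)

/-- The `ε`-net theorem of Vapnik–Chervonenkis and Haussler–Welzl. -/
theorem measureReal_exists_missed_le {G : ℕ} {ε : ℝ} (hε : 2 ≤ ε * Fintype.card ι)
    (hG : ∀ y : ι × Bool → Ω, ((y ⁻¹' ·) '' 𝓔).ncard ≤ G) :
    (Measure.pi fun _ : ι => D).real {x | ∃ E ∈ 𝓔, ε < D.real E ∧ ∀ i, x i ∉ E} ≤
      8 * G * Real.exp (-(ε * Fintype.card ι / 4)) := by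
  set m := Fintype.card ι
  obtain ⟨a, ha⟩ : ∃ a, ⌊ε * m / 2⌋₊ = a + 1 :=
    Nat.exists_eq_succ_of_ne_zero (Nat.floor_pos.2 (by linarith)).ne'
  have ha_le : (a : ℝ) + 1 ≤ ε * m / 2 := by
    exact_mod_cast ha ▸ Nat.floor_le (by linarith : 0 ≤ ε * m / 2)
  have ha_ge : ε * m / 2 ≤ a + 2 := by
    have := (Nat.lt_floor_add_one (ε * m / 2)).le
    rw [ha] at this
    push_cast at this
    linarith
  have hhits (E : Set Ω) (hE : ε < D.real E) := half_le_measureReal_hits (ι := ι) D hE ha_le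
  have hexp : Real.exp (ε * m / 4) ≤ 2 ^ (a + 2) := by
    have hhalf : Real.exp (1 / 2) ≤ 2 := by
      rw [← Real.le_log_iff_exp_le two_pos]
      linarith [Real.log_two_gt_d9]
    calc Real.exp (ε * m / 4) ≤ Real.exp ((a + 2 : ℕ) * (1 / 2)) := by
          gcongr; push_cast; linarith
      _ = Real.exp (1 / 2) ^ (a + 2) := Real.exp_nat_mul _ _
      _ ≤ 2 ^ (a + 2) := by gcongr
  calc _ ≤ 2 * (G / 2 ^ a : ℝ) := by
        linarith [half_mul_measureReal_missed_le (𝓔 := 𝓔) D hhits,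
          measureReal_missedThenHit_le (a := a) D hG]
    _ = 8 * G * (2 ^ (a + 2))⁻¹ := by field_simp; ring
    _ ≤ 8 * G * (Real.exp (ε * m / 4))⁻¹ := by gcongr
    _ = 8 * G * Real.exp (-(ε * m / 4)) := by rw [Real.exp_neg]

end Symmetrization

/-! ### Consistency on Chain-of-Thought samples -/

theorem cot_succ (f : Gen) (T : ℕ) (x : Str) : cot f (T + 1) x = cot f T x ++ [f (cot f T x)] := by
  simp only [cot, Function.iterate_succ_apply', applyAppend]

theorem length_cot (f : Gen) (T : ℕ) (x : Str) : (cot f T x).length = x.length + T := by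
  induction T with
  | zero => rfl
  | succ T ih => rw [cot_succ, List.length_append, ih]; rfl

theorem cot_eq_cot_iff {f h : Gen} {T : ℕ} {x : Str} :
    cot h T x = cot f T x ↔ ∀ j < T, h (cot f j x) = f (cot f j x) := by
  induction T with
  | zero => simp [cot]
  | succ T ih =>
    rw [cot_succ, cot_succ, List.append_singleton_inj, Nat.forall_lt_succ_right, ← ih]
    exact and_congr_right fun hcot => by rw [hcot]

/-- The inputs on which `h` and `f` have different `T`-step Chains-of-Thought. -/
def cotDisagreement (f : Gen) (T : ℕ) (h : Gen) : Set Str := {y | cot h T y ≠ cot f T y}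

theorem ncard_traces_cotDisagreement_le {H : Set Gen} {k : ℕ} (hk : vcDim H = k) (f : Gen) (T : ℕ)
    {κ : Type*} [Fintype κ] (z : κ → Str) :
    ((z ⁻¹' ·) '' (cotDisagreement f T '' H)).ncard ≤ (Fintype.card κ * T + 1) ^ k := by
  let u (p : κ × Fin T) : Str := cot f p.2 (z p.1)
  let disagree (g : κ × Fin T → Bool) : Set κ := {i | ∃ j, g (i, j) ≠ f (u (i, j))}
  have htrace (h : Gen) : z ⁻¹' cotDisagreement f T h = disagree (h ∘ u) := by
    ext i
    simp [cotDisagreement, cot_eq_cot_iff, disagree, u, Fin.exists_iff]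
  calc ((z ⁻¹' ·) '' (cotDisagreement f T '' H)).ncard
      = (disagree '' ((· ∘ u) '' H)).ncard := by simp only [Set.image_image, htrace]
    _ ≤ ((· ∘ u) '' H).ncard := Set.ncard_image_le (Set.toFinite _)
    _ ≤ (Fintype.card κ * T + 1) ^ k := by simpa using ncard_image_comp_le_pow hk u

theorem measureReal_exists_consistent_le (D : Measure Str) [IsProbabilityMeasure D] {H : Set Gen}
    {k : ℕ} (hk : vcDim H = k) (f : Gen) (T : ℕ) {m : ℕ} {ε : ℝ} (hm : 2 ≤ ε * m) :
    (Measure.pi fun _ : Fin m => D).real {x | ∃ h ∈ H, ε < D.real {y | e2e h T y ≠ e2e f T y} ∧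
      ∀ i, cot h T (x i) = cot f T (x i)} ≤
        8 * (2 * m * T + 1) ^ k * Real.exp (-(ε * m / 4)) := by
  have hnet := measureReal_exists_missed_le (ι := Fin m) D (by simpa using hm)
    fun y => ncard_traces_cotDisagreement_le hk f T y
  simp only [Fintype.card_prod, Fintype.card_bool, Fintype.card_fin, Nat.cast_pow, Nat.cast_add,
    Nat.cast_mul, Nat.cast_ofNat, Nat.cast_one, mul_comm (m : ℝ) 2] at hnet
  refine (measureReal_mono ?_).trans hnet
  rintro x ⟨h, hH, hε, hx⟩
  have he2e : {y | e2e h T y ≠ e2e f T y} ⊆ cotDisagreement f T h :=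
    fun y hy hcot => hy (by rw [e2e, hcot, e2e])
  exact ⟨_, ⟨h, hH, rfl⟩, hε.trans_le (measureReal_mono he2e), fun i => not_not_intro (hx i)⟩

/-- The number of examples from which consistent rules learn a class of VC dimension `k`. The second
term makes `ε m` at least `16 k √(2 m T)`, which absorbs the growth function `(2 m T + 1) ^ k`. -/
noncomputable def sampleSize (k T : ℕ) (ε δ : ℝ) : ℕ :=
  ⌈(24 + 8 * Real.log (1 / δ)) / ε + 512 * k ^ 2 * T / ε ^ 2⌉₊

section SampleSize

variable {k T m : ℕ} {ε δ : ℝ}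

theorem le_mul_sampleSize (hε : 0 < ε) :
    24 + 8 * Real.log (1 / δ) ≤ ε * sampleSize k T ε δ := by
  have hceil : (24 + 8 * Real.log (1 / δ)) / ε ≤ sampleSize k T ε δ :=
    (le_add_of_nonneg_right (by positivity)).trans (Nat.le_ceil _)
  rwa [div_le_iff₀' hε] at hceil

theorem le_sq_mul_sampleSize (hε : 0 < ε) (hδ : 0 < δ) (hδ1 : δ < 1) :
    512 * (k : ℝ) ^ 2 * T ≤ ε ^ 2 * sampleSize k T ε δ := by
  have hlog : 0 ≤ Real.log (1 / δ) := Real.log_nonneg (one_le_one_div hδ hδ1.le)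
  have hceil : 512 * (k : ℝ) ^ 2 * T / ε ^ 2 ≤ sampleSize k T ε δ :=
    (le_add_of_nonneg_left (by positivity)).trans (Nat.le_ceil _)
  rwa [div_le_iff₀' (by positivity)] at hceil

theorem growth_le_exp (hε : 0 < ε) (hm : 512 * (k : ℝ) ^ 2 * T ≤ ε ^ 2 * m) :
    (2 * m * T + 1 : ℝ) ^ k ≤ Real.exp (ε * m / 8) := by
  set s := √(2 * m * T)
  have hs : s ^ 2 = 2 * m * T := Real.sq_sqrt (by positivity)
  have hks : 16 * (k * s) ≤ ε * m := by
    refine le_of_sq_le_sq ?_ (by positivity)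
    calc (16 * (k * s)) ^ 2 = 512 * k ^ 2 * T * m := by rw [mul_pow, mul_pow, hs]; ring
      _ ≤ ε ^ 2 * m * m := by gcongr
      _ = (ε * m) ^ 2 := by ring
  calc (2 * m * T + 1 : ℝ) ^ k = (s ^ 2 + 1) ^ k := by rw [hs]
    _ ≤ ((s + 1) ^ 2) ^ k := by gcongr; nlinarith [Real.sqrt_nonneg (2 * m * T : ℝ)]
    _ ≤ (Real.exp s ^ 2) ^ k := by gcongr; exact Real.add_one_le_exp s
    _ = Real.exp (2 * (k * s)) := by
        rw [← pow_mul, ← Real.exp_nat_mul]; congr 1; push_cast; ring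
    _ ≤ Real.exp (ε * m / 8) := by gcongr; linarith

theorem failure_le_of_sampleSize (hε : 0 < ε) (hδ : 0 < δ) (hδ1 : δ < 1) :
    8 * (2 * sampleSize k T ε δ * T + 1 : ℝ) ^ k * Real.exp (-(ε * sampleSize k T ε δ / 4)) ≤
      δ := by
  have hgrowth := growth_le_exp hε (le_sq_mul_sampleSize (k := k) (T := T) hε hδ hδ1)
  have hlin := le_mul_sampleSize (k := k) (T := T) (δ := δ) hε
  set m := sampleSize k T ε δ
  have height : (8 : ℝ) ≤ Real.exp 3 :=
    calc (8 : ℝ) = 2 ^ 3 := by norm_num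
      _ ≤ Real.exp 1 ^ 3 := by gcongr; linarith [Real.add_one_le_exp 1]
      _ = Real.exp 3 := by rw [← Real.exp_nat_mul]; norm_num
  calc 8 * (2 * m * T + 1 : ℝ) ^ k * Real.exp (-(ε * m / 4))
      ≤ Real.exp 3 * Real.exp (ε * m / 8) * Real.exp (-(ε * m / 4)) := by gcongr
    _ = Real.exp (3 - ε * m / 8) := by rw [← Real.exp_add, ← Real.exp_add]; ring_nf
    _ ≤ Real.exp (Real.log δ) := by
        rw [one_div, Real.log_inv] at hlin
        gcongr
        linarith
    _ = δ := Real.exp_log hδ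

end SampleSize

theorem CoTLearns.of_consistent {H : Set Gen} {k : ℕ} (hk : vcDim H = k) (T : ℕ) (X : Set Str)
    (A : List Str → Gen) (hA : ∀ f ∈ H, ∀ xs : List Str, A (cotSample f T xs) ∈ H ∧
      cotSample (A (cotSample f T xs)) T xs = cotSample f T xs) :
    CoTLearns H T X (fun S => e2e (A S) T) (sampleSize k T) := by
  intro D _ _ f hf ε δ hε _ hδ hδ1
  have hlog : 0 ≤ Real.log (1 / δ) := Real.log_nonneg (one_le_one_div hδ hδ1.le)
  set m := sampleSize k T ε δ
  have hlarge : 2 ≤ ε * m := by linarith [le_mul_sampleSize (k := k) (T := T) (δ := δ) hε]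
  set bad := {x : Fin m → Str | ∃ h ∈ H, ε < D.real {y | e2e h T y ≠ e2e f T y} ∧
    ∀ i, cot h T (x i) = cot f T (x i)}
  have hbad : (Measure.pi fun _ => D).real bad ≤ δ :=
    (measureReal_exists_consistent_le D hk f T hlarge).trans
      (failure_le_of_sampleSize hε hδ hδ1)
  calc ENNReal.ofReal (1 - δ) ≤ ENNReal.ofReal ((Measure.pi fun _ => D).real badᶜ) := by
        rw [probReal_compl_eq_one_sub .of_discrete]
        exact ENNReal.ofReal_le_ofReal (sub_le_sub_left hbad 1)
    _ = (Measure.pi fun _ => D) badᶜ := ofReal_measureReal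
    _ ≤ _ := measure_mono fun x hx => by
        obtain ⟨hH, hcons⟩ := hA f hf (List.ofFn x)
        have hcot (i : Fin m) := List.map_inj_left.1 hcons _ (List.mem_ofFn.2 ⟨i, rfl⟩)
        have herr := not_lt.1 fun hlt => hx ⟨_, hH, hlt, hcot⟩
        exact (ENNReal.le_ofReal_iff_toReal_le (measure_ne_top _ _) hε.le).2 herr

/-! ### Polynomial bounds -/

theorem exists_abs_eval_le_eval {σ τ : Type*} (p : MvPolynomial σ ℝ) (f : σ → MvPolynomial τ ℝ) :
    ∃ q : MvPolynomial τ ℝ, ∀ (x : σ → ℝ) (v : τ → ℝ),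
      (∀ i, |x i| ≤ MvPolynomial.eval v (f i)) →
        |MvPolynomial.eval x p| ≤ MvPolynomial.eval v q := by
  induction p using MvPolynomial.induction_on with
  | C a => exact ⟨MvPolynomial.C |a|, fun x v _ => by simp⟩
  | add p₁ p₂ h₁ h₂ =>
    obtain ⟨q₁, hq₁⟩ := h₁
    obtain ⟨q₂, hq₂⟩ := h₂
    refine ⟨q₁ + q₂, fun x v hx => ?_⟩
    rw [map_add, map_add]
    exact (abs_add_le _ _).trans (add_le_add (hq₁ x v hx) (hq₂ x v hx))
  | mul_X p i h =>
    obtain ⟨q, hq⟩ := h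
    refine ⟨q * f i, fun x v hx => ?_⟩
    rw [map_mul, map_mul, MvPolynomial.eval_X, abs_mul]
    exact mul_le_mul (hq x v hx) (hx i) (abs_nonneg _) ((abs_nonneg _).trans (hq x v hx))

theorem VCPolyBounded.exists_sampleSize_le_bound {F : ℕ → Set Gen} (hVC : VCPolyBounded F) :
    ∃ (k : ℕ → ℕ) (r : MvPolynomial (Fin 5) ℝ), (∀ d, vcDim (F d) = k d) ∧
      ∀ (n d T : ℕ) (ε δ : ℝ), 0 < ε → 0 < δ → δ < 1 →
        (sampleSize (k d) T ε δ : ℝ) ≤ bound r n d T ε δ := by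
  obtain ⟨p, hp⟩ := hVC
  choose k hk hkp using hp
  refine ⟨k, (24 + 8 * .X 4) * .X 3 +
    512 * (Polynomial.aeval (MvPolynomial.X 1) p) ^ 2 * .X 2 * .X 3 ^ 2 + 1, hk,
    fun n d T ε δ hε hδ hδ1 => ?_⟩
  have hlog : 0 ≤ Real.log (1 / δ) := Real.log_nonneg (one_le_one_div hδ hδ1.le)
  have heval (v : Fin 5 → ℝ) :
      MvPolynomial.eval v (Polynomial.aeval (MvPolynomial.X 1) p) = p.eval (v 1) := by
    rw [← MvPolynomial.coe_aeval_eq_eval, RingHom.coe_coe, ← Polynomial.aeval_algHom_apply]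
    simp
  calc (sampleSize (k d) T ε δ : ℝ)
      ≤ (24 + 8 * Real.log (1 / δ)) / ε + 512 * (k d : ℝ) ^ 2 * T / ε ^ 2 + 1 :=
        (Nat.ceil_lt_add_one (by positivity)).le
    _ ≤ (24 + 8 * Real.log (1 / δ)) / ε + 512 * p.eval (d : ℝ) ^ 2 * T / ε ^ 2 + 1 := by
        gcongr
        exact hkp d
    _ = _ := by
        simp only [bound, map_add, map_mul, map_pow, map_ofNat, map_one, MvPolynomial.eval_X, heval]
        simp [div_eq_mul_inv]

/-! ### Running times of programs -/

/-- Halting with a time bound: started in `s`, the program `p` halts in `s'` within `B` steps.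
Unlike for `Run`, the bound may be weakened, so that it composes without tracking exact step
counts. -/
def Exec (p : Prog) (s s' : Store) (B : ℕ) : Prop := ∃ t ≤ B, Run p s t s'

namespace Exec

variable {p q : Prog} {s s' s'' : Store} {B B' : ℕ} {r : ℕ} {o : Option Symb}

theorem mono (h : Exec p s s' B) (hB : B ≤ B') : Exec p s s' B' :=
  let ⟨t, ht, hrun⟩ := h
  ⟨t, ht.trans hB, hrun⟩

theorem congr_right (h : Exec p s s' B) (hs : s' = s'') : Exec p s s'' B := hs ▸ h

theorem seq (h : Exec p s s' B) (h' : Exec q s' s'' B') : Exec (p.seq q) s s'' (B + B') :=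
  let ⟨_, ht, hrun⟩ := h
  let ⟨_, ht', hrun'⟩ := h'
  ⟨_, add_le_add ht ht', .seq hrun hrun'⟩

theorem push (a : Symb) : Exec (.push r a) s (Function.update s r (a :: s r)) 1 :=
  ⟨_, le_rfl, .push r a s⟩

theorem pop : Exec (.pop r) s (Function.update s r (s r).tail) 1 :=
  ⟨_, le_rfl, .pop r s⟩

theorem condThen (ho : (s r).head? = o) (h : Exec p s s' B) : Exec (.cond r o p q) s s' (B + 1) :=
  let ⟨_, ht, hrun⟩ := h
  ⟨_, Nat.add_le_add_right ht 1, .condThen ho hrun⟩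

theorem condElse (ho : (s r).head? ≠ o) (h : Exec q s s' B) : Exec (.cond r o p q) s s' (B + 1) :=
  let ⟨_, ht, hrun⟩ := h
  ⟨_, Nat.add_le_add_right ht 1, .condElse ho hrun⟩

theorem loopDone (ho : (s r).head? = o) : Exec (.loopUntil r o p) s s 1 :=
  ⟨_, le_rfl, .loopDone ho⟩

theorem loopStep (ho : (s r).head? ≠ o) (h : Exec p s s' B)
    (h' : Exec (.loopUntil r o p) s' s'' B') : Exec (.loopUntil r o p) s s'' (B + B' + 1) :=
  let ⟨_, ht, hrun⟩ := h
  let ⟨_, ht', hrun'⟩ := h'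
  ⟨_, Nat.add_le_add_right (add_le_add ht ht') 1, .loopStep ho hrun hrun'⟩

theorem outputs {inputs : List (List Symb)} {out : List Symb} {b : ℝ}
    (h : Exec p (load inputs) s B) (hout : s 0 = out) (hB : B ≤ b) : p.Outputs inputs out b :=
  let ⟨t, ht, hrun⟩ := h
  ⟨t, s, hrun, hout, (Nat.cast_le.2 ht).trans hB⟩

theorem seq_outputs {inputs inputs' : List (List Symb)} {out : List Symb} {b : ℝ}
    (h : Exec p (load inputs) (load inputs') B) (h' : q.Outputs inputs' out b) :
    (p.seq q).Outputs inputs out (B + b) :=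
  let ⟨_, ht, hrun⟩ := h
  let ⟨_, s, hrun', hout, ht'⟩ := h'
  ⟨_, s, .seq hrun hrun', hout, by push_cast; gcongr⟩

end Exec

theorem Run.length_le {p : Prog} {s s' : Store} {t : ℕ} (h : Run p s t s') (r : ℕ) :
    (s' r).length ≤ (s r).length + t := by
  induction h with
  | skip s => omega
  | push r' a s => rcases eq_or_ne r r' with rfl | hr <;> simp [*]
  | pop r' s => rcases eq_or_ne r r' with rfl | hr <;> simp +arith [*]
  | seq _ _ ih ih' => omega
  | condThen _ _ ih => omega
  | condElse _ _ ih => omega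
  | loopDone _ => omega
  | loopStep _ _ _ ih ih' => omega

theorem Prog.Outputs.mono {p : Prog} {out : List Symb} {inputs : List (List Symb)} {b b' : ℝ}
    (h : p.Outputs inputs out b) (hb : b ≤ b') : p.Outputs inputs out b' :=
  let ⟨t, s, hrun, hout, ht⟩ := h
  ⟨t, s, hrun, hout, ht.trans hb⟩

theorem Prog.Outputs.length_le {p : Prog} {input out : List Symb} {inputs : List (List Symb)}
    {b : ℝ} (h : p.Outputs (input :: inputs) out b) : (out.length : ℝ) ≤ input.length + b := by
  obtain ⟨t, s, hrun, rfl, ht⟩ := h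
  have hlen : ((s 0).length : ℝ) ≤ input.length + t := by exact_mod_cast hrun.length_le 0
  linarith

theorem update_load {L : List (List Symb)} {r : ℕ} (hr : r < L.length) (v : List Symb) :
    Function.update (load L) r v = load (L.set r v) := by
  funext i
  by_cases h : i = r
  · subst h; simp [load, hr]
  · simp [load, h, List.getD_eq_getElem?_getD, List.getElem?_set_ne (Ne.symm h)]

theorem load_append_replicate (L : List (List Symb)) (k : ℕ) :
    load (L ++ List.replicate k []) = load L := by
  funext i
  simp only [load, List.getD_eq_getElem?_getD, List.getElem?_append]
  split_ifs with h
  · rfl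
  · rw [List.getElem?_replicate, List.getElem?_eq_none (not_lt.1 h)]
    split_ifs <;> rfl

/-! ### Moving, copying and clearing stacks -/

/-- Push the top of the nonempty stack `r` onto stack `r'`. -/
def Prog.pushTop (r r' : ℕ) : Prog :=
  .cond r (some (.bit true)) (.push r' (.bit true))
    (.cond r (some (.bit false)) (.push r' (.bit false)) (.push r' .sep))

/-- Move stack `r` onto stack `r'`, reversing it, until the top of `r` is `o`. -/
def Prog.moveUntil (r : ℕ) (o : Option Symb) (r' : ℕ) : Prog :=
  .loopUntil r o (.seq (.pushTop r r') (.pop r))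

/-- Move stack `r`, reversed, onto each of the stacks `r'` and `c`. -/
def Prog.moveTwice (r r' c : ℕ) : Prog :=
  .loopUntil r none (.seq (.pushTop r r') (.seq (.pushTop r c) (.pop r)))

/-- Copy the reverse of stack `r` onto stack `r'`, with the help of the empty stack `c`. -/
def Prog.copyRev (r r' c : ℕ) : Prog := .seq (.moveTwice r r' c) (.moveUntil c none r)

/-- Empty the stack `r`. -/
def Prog.clear (r : ℕ) : Prog := .loopUntil r none (.pop r)

namespace Exec

variable {s : Store} {r r' c : ℕ} {o : Option Symb} {a : Symb} {l l' : List Symb}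

theorem pushTop (h : (s r).head? = some a) :
    Exec (.pushTop r r') s (Function.update s r' (a :: s r')) 3 := by
  rcases a with (_ | _) | _
  · exact .condElse (by simp [h]) (.condThen h (.push _))
  · exact (condThen h (.push _)).mono (by omega)
  · exact .condElse (by simp [h]) (.condElse (by simp [h]) (.push _))

theorem moveUntil (hr : r ≠ r') (hs : s r = l ++ l') (hl : ∀ a ∈ l, some a ≠ o)
    (hl' : l'.head? = o) :
    Exec (.moveUntil r o r') s
      (Function.update (Function.update s r l') r' (l.reverse ++ s r')) (5 * l.length + 1) := by
  induction l generalizing s with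
  | nil =>
    refine (loopDone (hs ▸ hl')).congr_right ?_
    funext i
    by_cases h1 : i = r' <;> by_cases h2 : i = r <;> simp_all
  | cons a l ih =>
    have htop : (s r).head? = some a := by rw [hs]; rfl
    obtain ⟨ha, hl⟩ := List.forall_mem_cons.1 hl
    refine (loopStep (htop ▸ ha) ((pushTop htop).seq .pop) (ih ?_ hl)).congr_right ?_ |>.mono ?_
    · simp [hr, hs]
    · funext i
      by_cases h1 : i = r' <;> by_cases h2 : i = r <;> simp_all
    · rw [List.length_cons]; omega

theorem moveUntil_none (hr : r ≠ r') :
    Exec (.moveUntil r none r') s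
      (Function.update (Function.update s r []) r' ((s r).reverse ++ s r'))
      (5 * (s r).length + 1) :=
  moveUntil hr (List.append_nil _).symm (by simp) rfl

theorem moveTwice (hr : r ≠ r') (hc : r ≠ c) (hc' : r' ≠ c) (hs : s r = l) :
    Exec (.moveTwice r r' c) s
      (Function.update (Function.update (Function.update s r []) r' (l.reverse ++ s r'))
        c (l.reverse ++ s c)) (8 * l.length + 1) := by
  induction l generalizing s with
  | nil =>
    refine (loopDone (by rw [hs]; rfl)).congr_right ?_
    funext i
    by_cases h1 : i = r' <;> by_cases h2 : i = r <;> by_cases h3 : i = c <;> simp_all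
  | cons a l ih =>
    have htop : (s r).head? = some a := by rw [hs]; rfl
    have htop' : (Function.update s r' (a :: s r') r).head? = some a := by simp [hr, htop]
    refine (loopStep (by simp [htop]) ((pushTop htop).seq ((pushTop htop').seq .pop))
      (ih ?_)).congr_right ?_ |>.mono ?_
    · simp [hr, hc, hs]
    · have hr' := hr.symm
      have hc'' := hc'.symm
      funext i
      by_cases h1 : i = r' <;> by_cases h2 : i = r <;> by_cases h3 : i = c <;> simp_all
    · rw [List.length_cons]; omega

theorem copyRev (hr : r ≠ r') (hc : r ≠ c) (hc' : r' ≠ c) (h0 : s c = []) :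
    Exec (.copyRev r r' c) s (Function.update s r' ((s r).reverse ++ s r'))
      (13 * (s r).length + 2) := by
  refine ((moveTwice hr hc hc' rfl).seq (moveUntil_none hc.symm)).congr_right ?_ |>.mono ?_
  · funext i
    by_cases h1 : i = r' <;> by_cases h2 : i = r <;> by_cases h3 : i = c <;> simp_all
  · simp only [h0, List.append_nil, Function.update_self, List.length_reverse]
    omega

theorem clear : Exec (.clear r) s (Function.update s r []) (2 * (s r).length + 1) := by
  generalize hl : s r = l
  induction l generalizing s with
  | nil => exact (loopDone (by rw [hl]; rfl)).congr_right (by rw [← hl, Function.update_eq_self])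
  | cons a l ih =>
    refine (loopStep (by simp [hl]) .pop (ih (by simp [hl]))).congr_right (by simp) |>.mono ?_
    rw [List.length_cons]; omega

end Exec

/-! ### Training on next-token examples -/

/-- The next-token prediction examples obtained from a reversed string `r` by cutting off the last
`t` tokens of the string one by one. -/
def nextTokenExamples : ℕ → Str → List (Str × Bool)
  | t + 1, v :: r => nextTokenExamples t r ++ [(r.reverse, v)]
  | _, _ => []

/-- The next-token prediction examples contained in a sample `S` of `T`-step Chains-of-Thought. The
strings are taken in reverse order, in which a program collects the examples on a stack. -/
def nextTokenSample (T : ℕ) (S : List Str) : List (Str × Bool) :=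
  S.reverse.flatMap fun z => nextTokenExamples T z.reverse

theorem nextTokenSample_cons (T : ℕ) (z : Str) (S : List Str) :
    nextTokenSample T (z :: S) = nextTokenSample T S ++ nextTokenExamples T z.reverse := by
  simp [nextTokenSample]

theorem mem_nextTokenExamples_cot {f : Gen} {T : ℕ} {x : Str} {e : Str × Bool} :
    e ∈ nextTokenExamples T (cot f T x).reverse ↔ ∃ j < T, (cot f j x, f (cot f j x)) = e := by
  induction T with
  | zero => simp [nextTokenExamples]
  | succ T ih =>
    rw [cot_succ, List.reverse_append, List.reverse_singleton, List.singleton_append,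
      nextTokenExamples, List.reverse_reverse, List.mem_append, ih, List.mem_singleton,
      Nat.exists_lt_succ_right, @eq_comm _ e]

theorem forall_mem_nextTokenSample_iff {f h : Gen} {T : ℕ} {xs : List Str} :
    (∀ e ∈ nextTokenSample T (cotSample f T xs), h e.1 = e.2) ↔
      cotSample h T xs = cotSample f T xs := by
  simp only [nextTokenSample, cotSample, List.mem_flatMap, List.mem_reverse, List.mem_map,
    List.map_inj_left, cot_eq_cot_iff]
  constructor
  · exact fun hS x hx j hj => hS _ ⟨_, ⟨x, hx, rfl⟩, mem_nextTokenExamples_cot.2 ⟨j, hj, rfl⟩⟩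
  · rintro hS e ⟨_, ⟨x, hx, rfl⟩, he⟩
    obtain ⟨j, hj, rfl⟩ := mem_nextTokenExamples_cot.1 he
    exact hS x hx j hj

theorem length_encLabelled_nextTokenExamples_le (t : ℕ) (r : Str) :
    (encLabelled (nextTokenExamples t r)).length ≤ t * (r.length + 1) := by
  induction t generalizing r with
  | zero => simp [nextTokenExamples, encLabelled]
  | succ t ih =>
    cases r with
    | nil => simp [nextTokenExamples, encLabelled]
    | cons v r =>
      calc (encLabelled (nextTokenExamples (t + 1) (v :: r))).length
          = (encLabelled (nextTokenExamples t r)).length + (r.length + 2) := by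
            simp [nextTokenExamples, encLabelled, encStr]
        _ ≤ t * (r.length + 1) + (r.length + 2) := Nat.add_le_add_right (ih r) _
        _ ≤ (t + 1) * ((v :: r).length + 1) := by rw [List.length_cons]; nlinarith

theorem encStrs_cons (z : Str) (S : List Str) :
    encStrs (z :: S) = encStr z ++ .sep :: encStrs S := by
  simp [encStrs]

theorem length_encStrs_cons (z : Str) (S : List Str) :
    (encStrs (z :: S)).length = z.length + 1 + (encStrs S).length := by
  simp only [encStrs_cons, encStr, List.length_append, List.length_map, List.length_cons]
  omega

theorem length_encLabelled_nextTokenSample_le (T : ℕ) (S : List Str) :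
    (encLabelled (nextTokenSample T S)).length ≤ T * (encStrs S).length := by
  induction S with
  | nil => simp [nextTokenSample, encLabelled]
  | cons z S ih =>
    have hz := length_encLabelled_nextTokenExamples_le T z.reverse
    have happend (E E' : List (Str × Bool)) :
        encLabelled (E ++ E') = encLabelled E ++ encLabelled E' := List.flatMap_append
    rw [nextTokenSample_cons, happend, List.length_append, length_encStrs_cons]
    rw [List.length_reverse] at hz
    linarith

/-- Turn the last token of the reversed string on stack `3` into an example on stack `4`, moving one
unit of the counter on stack `2` to stack `6`. -/
def Prog.cutToken : Prog :=
  .seq (.pop 2) (.seq (.push 6 (.bit true)) (.seq (.pushTop 3 4) (.seq (.pop 3)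
    (.seq (.push 4 .sep) (.copyRev 3 4 5)))))

/-- Turn the first string of the sample on stack `0` into examples on stack `4`, the number of which
is on stack `2`. -/
def Prog.cutString : Prog :=
  .seq (.moveUntil 0 (some .sep) 3) (.seq (.pop 0) (.seq (.loopUntil 2 none .cutToken)
    (.seq (.moveUntil 6 none 2) (.clear 3))))

/-- Replace the Chain-of-Thought sample on stack `0` by the next-token examples it contains, the
length of the Chains-of-Thought being on stack `2`. -/
def Prog.cutSample : Prog :=
  .seq (.loopUntil 0 none .cutString)
    (.seq (.moveUntil 4 none 5) (.seq (.moveUntil 5 none 0) (.clear 2)))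

namespace Exec

theorem cutToken (A D : List Symb) (t c : ℕ) (v : Bool) (r : Str) (E : List (Str × Bool)) :
    Exec .cutToken
      (load [A, D, encNat (t + 1), encStr (v :: r), encLabelled E, [], encNat c])
      (load [A, D, encNat t, encStr r, encLabelled ((r.reverse, v) :: E), [], encNat (c + 1)])
      (13 * r.length + 9) := by
  refine (pop.seq ((push _).seq ((pushTop (a := .bit v) ?_).seq (pop.seq
    ((push _).seq (copyRev (by decide) (by decide) (by decide) ?_)))))).congr_right ?_ |>.mono ?_
  all_goals simp only [update_load, List.length_cons, List.length_nil, Nat.reduceLT, Nat.reduceAdd,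
    List.set_cons_succ, List.set_cons_zero]
  · rfl
  · rfl
  · simp [load, encLabelled, encStr, encNat, List.replicate_succ, List.map_reverse]
  · simp +arith [load, encStr]

theorem cutToken_loop (A D : List Symb) {t c L : ℕ} {r : Str} (ht : t ≤ r.length)
    (hL : r.length ≤ L) (E : List (Str × Bool)) :
    Exec (.loopUntil 2 none .cutToken)
      (load [A, D, encNat t, encStr r, encLabelled E, [], encNat c])
      (load [A, D, [], encStr (r.drop t), encLabelled (nextTokenExamples t r ++ E), [],
        encNat (c + t)])
      (t * (13 * L + 10) + 1) := by
  induction t generalizing r c E with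
  | zero =>
    refine (loopDone ?_).congr_right ?_ |>.mono (Nat.le_add_left 1 _)
    · rfl
    · simp [nextTokenExamples, encNat]
  | succ t ih =>
    cases r with
    | nil => simp at ht
    | cons v r =>
      rw [List.length_cons] at ht hL
      refine (loopStep (by simp [load, encNat, List.replicate_succ])
        (cutToken A D t c v r E) (ih (by omega) (by omega) _)).congr_right ?_ |>.mono ?_
      · simp [nextTokenExamples, add_assoc, add_comm 1 t]
      · linarith

theorem cutString (A D : List Symb) {T : ℕ} {z : Str} (hT : T ≤ z.length)
    (E : List (Str × Bool)) :
    Exec .cutString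
      (load [encStr z ++ .sep :: A, D, encNat T, [], encLabelled E, [], []])
      (load [A, D, encNat T, [], encLabelled (nextTokenExamples T z.reverse ++ E), [], []])
      (T * (13 * z.length + 15) + 7 * z.length + 5) := by
  set E' := encLabelled (nextTokenExamples T z.reverse ++ E)
  have hread : Exec (.moveUntil 0 (some .sep) 3)
      (load [encStr z ++ .sep :: A, D, encNat T, [], encLabelled E, [], []])
      (load [.sep :: A, D, encNat T, encStr z.reverse, encLabelled E, [], []])
      (5 * z.length + 1) := by
    refine (moveUntil (l := encStr z) (l' := .sep :: A) (by decide) rfl ?_ rfl).congr_right ?_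
      |>.mono ?_
    · rintro _ ha ⟨⟩
      simp [encStr] at ha
    · simp [update_load, encStr, load]
    · simp [encStr]
  have hsep : Exec (.pop 0) (load [.sep :: A, D, encNat T, encStr z.reverse, encLabelled E, [], []])
      (load [A, D, encNat T, encStr z.reverse, encLabelled E, [], encNat 0]) 1 :=
    pop.congr_right (by simp [update_load, load, encNat])
  have hcut := cutToken_loop A D (t := T) (c := 0) (r := z.reverse) (by simpa using hT) le_rfl E
  have hcounter : Exec (.moveUntil 6 none 2)
      (load [A, D, [], encStr (z.reverse.drop T), E', [], encNat (0 + T)])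
      (load [A, D, encNat T, encStr (z.reverse.drop T), E', [], []]) (5 * T + 1) := by
    refine (moveUntil_none (by decide)).congr_right ?_ |>.mono ?_
    · simp [update_load, load, encNat]
    · simp [load, encNat]
  have hclear : Exec (.clear 3) (load [A, D, encNat T, encStr (z.reverse.drop T), E', [], []])
      (load [A, D, encNat T, [], E', [], []]) (2 * z.length + 1) := by
    refine clear.congr_right (by simp [update_load]) |>.mono ?_
    simp [load, encStr]
  refine (hread.seq (hsep.seq (hcut.seq (hcounter.seq hclear)))).mono ?_
  rw [List.length_reverse]
  linarith

theorem cutString_loop (D : List Symb) {T : ℕ} {S : List Str} (hT : ∀ z ∈ S, T ≤ z.length)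
    (E : List (Str × Bool)) :
    Exec (.loopUntil 0 none .cutString)
      (load [encStrs S, D, encNat T, [], encLabelled E, [], []])
      (load [[], D, encNat T, [], encLabelled (nextTokenSample T S ++ E), [], []])
      (15 * (T + 1) * (encStrs S).length + 1) := by
  induction S generalizing E with
  | nil => exact (loopDone (by rfl)).mono (Nat.le_add_left 1 _)
  | cons z S ih =>
    obtain ⟨hz, hT⟩ := List.forall_mem_cons.1 hT
    have hnonempty : (encStr z ++ .sep :: encStrs S).head? ≠ none := by simp
    rw [nextTokenSample_cons, List.append_assoc, length_encStrs_cons, encStrs_cons]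
    refine (loopStep hnonempty (cutString _ D hz E) (ih hT _)).mono ?_
    linarith [Nat.zero_le (T * z.length)]

theorem cutSample (D : List Symb) {T : ℕ} {S : List Str} (hT : ∀ z ∈ S, T ≤ z.length) :
    Exec .cutSample (load [encStrs S, D, encNat T]) (load [encLabelled (nextTokenSample T S), D])
      (25 * (T + 1) * (encStrs S).length + 2 * T + 4) := by
  set E := encLabelled (nextTokenSample T S) with hE
  have hinit := load_append_replicate [encStrs S, D, encNat T] 4
  have hfinal := load_append_replicate [E, D] 5
  have hcut := cutString_loop D hT []
  rw [List.append_nil, ← hE] at hcut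
  have hflip : Exec (.moveUntil 4 none 5) (load [[], D, encNat T, [], E, [], []])
      (load [[], D, encNat T, [], [], E.reverse, []]) (5 * E.length + 1) :=
    (moveUntil_none (by decide)).congr_right (by simp [update_load, load])
  have hback : Exec (.moveUntil 5 none 0) (load [[], D, encNat T, [], [], E.reverse, []])
      (load [E, D, encNat T, [], [], [], []]) (5 * E.length + 1) := by
    refine (moveUntil_none (by decide)).congr_right ?_ |>.mono ?_
    · simp [update_load, load]
    · simp [load]
  have hclear : Exec (.clear 2) (load [E, D, encNat T, [], [], [], []])
      (load [E, D, [], [], [], [], []]) (2 * T + 1) := by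
    refine clear.congr_right ?_ |>.mono ?_
    · simp [update_load]
    · simp [load, encNat]
  rw [← hinit, ← hfinal]
  refine (hcut.seq (hflip.seq (hback.seq hclear))).mono ?_
  have hlen : E.length ≤ T * (encStrs S).length := length_encLabelled_nextTokenSample_le T S
  linarith

end Exec

theorem ConsInPolyTime.exists_train {F : ℕ → Set Gen} {ρ : ℕ → List Symb → Gen}
    (hCons : ConsInPolyTime F ρ) :
    ∃ (train : Prog) (A : ℕ → ℕ → List Str → List Symb) (q : MvPolynomial (Fin 3) ℝ),
      ∀ (d T : ℕ) (S : List Str), (∃ f ∈ F d, ∀ e ∈ nextTokenSample T S, f e.1 = e.2) →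
        ρ d (A d T S) ∈ F d ∧ (∀ e ∈ nextTokenSample T S, ρ d (A d T S) e.1 = e.2) ∧
        ((∀ z ∈ S, T ≤ z.length) → train.Outputs [encStrs S, encNat d, encNat T] (A d T S)
          (MvPolynomial.eval ![((encStrs S).length : ℝ), (d : ℝ), (T : ℝ)] q)) := by
  obtain ⟨cons, p, hcons⟩ := hCons
  choose! w hproper hconsistent houtputs using hcons
  obtain ⟨q, hq⟩ := exists_abs_eval_le_eval p ![(.X 2 * .X 0 : MvPolynomial (Fin 3) ℝ), .X 1]
  refine ⟨.seq .cutSample cons, fun d T S => w d (nextTokenSample T S),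
    25 * (.X 2 + 1) * .X 0 + 2 * .X 2 + 4 + q, fun d T S hfit =>
    ⟨hproper d _ hfit, hconsistent d _ hfit, fun hT => ?_⟩⟩
  have hlen : ((encLabelled (nextTokenSample T S)).length : ℝ) ≤ T * (encStrs S).length :=
    mod_cast length_encLabelled_nextTokenSample_le T S
  have hcons := hq ![((encLabelled (nextTokenSample T S)).length : ℝ), d]
    ![((encStrs S).length : ℝ), d, T] (by simpa [Fin.forall_fin_two] using hlen)
  simpa using (Exec.cutSample (encNat d) hT).seq_outputs
    ((houtputs d _ hfit).mono ((le_abs_self _).trans hcons))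

/-! ### Running a program next to stacks that it does not use -/

/-- A bound for the indices of the stacks that a program uses: all of them are smaller. -/
def Prog.numStacks : Prog → ℕ
  | .skip => 0
  | .push r _ => r + 1
  | .pop r => r + 1
  | .seq p q => max p.numStacks q.numStacks
  | .cond r _ p q => max (r + 1) (max p.numStacks q.numStacks)
  | .loopUntil r _ p => max (r + 1) p.numStacks

/-- The memory with the stacks of `a` below `N`, where a program using at most `N` stacks can be run
as a subroutine, and the stacks of `b` from `N` on, where they are safe from it. -/
def glue (N : ℕ) (a b : Store) : Store := fun r => if r < N then a r else b (r - N)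

section Glue

variable {N i j : ℕ} {a b : Store}

theorem glue_of_lt (hi : i < N) : glue N a b i = a i := if_pos hi

theorem glue_add : glue N a b (N + i) = b i := by simp [glue]

theorem update_glue_of_lt (hi : i < N) (v : List Symb) :
    Function.update (glue N a b) i v = glue N (Function.update a i v) b := by
  funext r
  by_cases h : r = i
  · subst h; simp [glue, hi]
  · simp [glue, h]

theorem update_glue_add (v : List Symb) :
    Function.update (glue N a b) (N + i) v = glue N a (Function.update b i v) := by
  funext r
  by_cases hr : r < N
  · simp [glue, hr, (show r ≠ N + i by omega)]
  · obtain ⟨j, rfl⟩ := Nat.exists_eq_add_of_le (not_lt.1 hr)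
    by_cases hj : j = i <;> simp [glue, hj]

theorem glue_load_nil {L : List (List Symb)} (hL : L.length ≤ N) :
    glue N (load L) (load []) = load L := by
  funext r
  by_cases hr : r < N
  · exact glue_of_lt hr
  · simp [glue, hr, load, List.getElem?_eq_none (show L.length ≤ r by omega)]

theorem Run.frame {p : Prog} {s s' : Store} {t : ℕ} (h : Run p s t s') (hN : p.numStacks ≤ N)
    (b : Store) : Run p (glue N s b) t (glue N s' b) := by
  induction h with
  | skip s => exact .skip _
  | push r a s =>
    rw [← update_glue_of_lt hN, ← glue_of_lt (a := s) (b := b) hN]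
    exact .push _ _ _
  | pop r s =>
    rw [← update_glue_of_lt hN, ← glue_of_lt (a := s) (b := b) hN]
    exact .pop _ _
  | seq _ _ ih ih' =>
    obtain ⟨hp, hq⟩ := max_le_iff.1 hN
    exact .seq (ih hp) (ih' hq)
  | condThen ho _ ih =>
    obtain ⟨hr, hpq⟩ := max_le_iff.1 hN
    exact .condThen (by rwa [glue_of_lt hr]) (ih (max_le_iff.1 hpq).1)
  | condElse ho _ ih =>
    obtain ⟨hr, hpq⟩ := max_le_iff.1 hN
    exact .condElse (by rwa [glue_of_lt hr]) (ih (max_le_iff.1 hpq).2)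
  | loopDone ho => exact .loopDone (by rwa [glue_of_lt (max_le_iff.1 hN).1])
  | loopStep ho _ _ ih ih' =>
    obtain ⟨hr, hp⟩ := max_le_iff.1 hN
    exact .loopStep (by rwa [glue_of_lt hr]) (ih hp) (ih' hN)

/-- Empty all stacks below `N`. -/
def Prog.clearBelow : ℕ → Prog
  | 0 => .skip
  | N + 1 => .seq (clearBelow N) (.clear N)

namespace Exec

theorem frame {p : Prog} {s s' : Store} {B : ℕ} (h : Exec p s s' B) (hN : p.numStacks ≤ N)
    (b : Store) : Exec p (glue N s b) (glue N s' b) B :=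
  let ⟨t, ht, hrun⟩ := h
  ⟨t, ht, hrun.frame hN b⟩

theorem moveUntil_none_glue (hi : i < N) :
    Exec (.moveUntil i none (N + j)) (glue N a b)
      (glue N (Function.update a i []) (Function.update b j ((a i).reverse ++ b j)))
      (5 * (a i).length + 1) := by
  have h := moveUntil_none (s := glue N a b) (show i ≠ N + j by omega)
  rwa [glue_of_lt hi, glue_add, update_glue_of_lt hi, update_glue_add] at h

theorem copyRev_glue {c : ℕ} (hj : j < N) (hc : i ≠ c) (hb : b c = []) :
    Exec (.copyRev (N + i) j (N + c)) (glue N a b)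
      (glue N (Function.update a j ((b i).reverse ++ a j)) b)
      (13 * (b i).length + 2) := by
  have h := copyRev (s := glue N a b) (show N + i ≠ j by omega)
    (show N + i ≠ N + c by omega) (show j ≠ N + c by omega) (by rwa [glue_add])
  rwa [glue_of_lt hj, glue_add, update_glue_of_lt hj] at h

theorem clearBelow {M : ℕ} {s : Store} (hs : ∀ r < N, (s r).length ≤ M) :
    Exec (.clearBelow N) s (fun r => if r < N then [] else s r) (N * (2 * M + 1) + 1) := by
  induction N with
  | zero => exact (show Exec .skip s s 1 from ⟨_, le_rfl, .skip s⟩).mono (by simp)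
  | succ N ih =>
    refine ((ih fun r hr => hs r (by omega)).seq clear).congr_right ?_ |>.mono ?_
    · funext r
      by_cases h : r = N
      · subst h; simp
      · simp [h, show r < N + 1 ↔ r < N by omega]
    · simp only [lt_irrefl, if_false]
      linarith [hs N (by omega)]

theorem clearBelow_glue {M : ℕ} (ha : ∀ r, (a r).length ≤ M) (b : Store) :
    Exec (.clearBelow N) (glue N a b) (glue N (load []) b)
      (N * (2 * M + 1) + 1) := by
  refine (clearBelow fun r hr => (glue_of_lt hr).symm ▸ ha r).congr_right ?_
  funext r
  by_cases hr : r < N <;> simp [glue, hr, load]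

end Exec

end Glue

/-! ### Predicting by generation -/

/-- The memory between two generation steps. The first `N` stacks are left to the evaluation
program; the description `w` and the current string `u` are kept in reverse, which makes it cheap to
copy them there and to append a token, and `t` tokens remain to be generated. -/
def generationStore (N : ℕ) (w : List Symb) (d t : ℕ) (u : Str) : Store :=
  glue N (load []) (load [w.reverse, encNat d, encNat t, encStr u.reverse, []])

/-- Move the inputs out of the way of the evaluation program. -/
def Prog.saveInputs (N : ℕ) : Prog :=
  .seq (.moveUntil 0 none (N + 0)) (.seq (.moveUntil 1 none (N + 1))
    (.seq (.moveUntil 2 none (N + 2)) (.moveUntil 3 none (N + 3))))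

/-- Give the description, the size parameter and the current string to the evaluation program. -/
def Prog.loadArguments (N : ℕ) : Prog :=
  .seq (.copyRev (N + 0) 0 (N + 4)) (.seq (.copyRev (N + 1) 1 (N + 4)) (.copyRev (N + 3) 2 (N + 4)))

/-- Append one token to the current string, computing it by the evaluation program `ev`. -/
def Prog.generateStep (ev : Prog) (N : ℕ) : Prog :=
  .seq (.pop (N + 2)) (.seq (.loadArguments N) (.seq ev
    (.seq (.pushTop 0 (N + 3)) (.clearBelow N))))

/-- Generate as many tokens as the third input says and output the last one. -/
def Prog.generate (ev : Prog) (N : ℕ) : Prog :=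
  .seq (.saveInputs N) (.seq (.loopUntil (N + 2) none (.generateStep ev N)) (.pushTop (N + 3) 0))

theorem reverse_encStr (u : Str) : (encStr u).reverse = encStr u.reverse := List.map_reverse.symm

theorem reverse_encNat (k : ℕ) : (encNat k).reverse = encNat k := List.reverse_replicate

namespace Exec

variable {N : ℕ} {ev : Prog} {w : List Symb} {d t E L : ℕ} {u : Str}

theorem saveInputs (hN : 4 ≤ N) (w : List Symb) (d t : ℕ) (u : Str) :
    Exec (.saveInputs N) (load [w, encNat d, encNat t, encStr u]) (generationStore N w d t u)
      (5 * (w.length + d + u.length + t) + 4) := by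
  have hinit : load [w, encNat d, encNat t, encStr u] =
      glue N (load [w, encNat d, encNat t, encStr u]) (load [[], [], [], [], []]) := by
    rw [show load [[], [], [], [], []] = load [] from load_append_replicate [] 5,
      glue_load_nil (by simpa using hN)]
  rw [hinit]
  refine ((moveUntil_none_glue (by omega)).seq ((moveUntil_none_glue (by omega)).seq
    ((moveUntil_none_glue (by omega)).seq (moveUntil_none_glue (by omega))))).congr_right ?_
    |>.mono ?_
  · rw [generationStore, ← load_append_replicate [] 4]
    simp [update_load, load, reverse_encStr, reverse_encNat]
  · simp +arith [load, encNat, encStr]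

theorem loadArguments (hN : 4 ≤ N) (w : List Symb) (d t : ℕ) (u : Str) :
    Exec (.loadArguments N) (generationStore N w d t u)
      (glue N (load [w, encNat d, encStr u])
        (load [w.reverse, encNat d, encNat t, encStr u.reverse, []]))
      (13 * (w.length + d + u.length) + 6) := by
  refine ((copyRev_glue (by omega) (by omega) rfl).seq ((copyRev_glue (by omega) (by omega) rfl).seq
    (copyRev_glue (by omega) (by omega) rfl))).congr_right ?_ |>.mono ?_
  · rw [← load_append_replicate [] 3]
    simp [update_load, load, reverse_encStr, reverse_encNat]
  · simp +arith [load, encNat, encStr]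

theorem generateStep {s : Store} {v : Bool} (hN : 4 ≤ N) (hev : ev.numStacks ≤ N)
    (h : Exec ev (load [w, encNat d, encStr u]) s E) (hs : s 0 = [.bit v])
    (hL : w.length + d + u.length ≤ L) :
    Exec (.generateStep ev N) (generationStore N w d (t + 1) u)
      (generationStore N w d t (u ++ [v])) (13 * L + 11 + E + N * (2 * (L + E) + 1)) := by
  have hcount : Exec (.pop (N + 2)) (generationStore N w d (t + 1) u)
      (generationStore N w d t u) 1 := by
    refine pop.congr_right ?_
    rw [generationStore, update_glue_add, glue_add, update_load (by simp)]
    simp [load, encNat, List.replicate_succ, generationStore]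
  have hload := loadArguments hN w d t u
  have happend : Exec (.pushTop 0 (N + 3))
      (glue N s (load [w.reverse, encNat d, encNat t, encStr u.reverse, []]))
      (glue N s (load [w.reverse, encNat d, encNat t, encStr (u ++ [v]).reverse, []]))
      3 := by
    refine (pushTop (a := .bit v) ?_).congr_right ?_
    · rw [glue_of_lt (by omega), hs]; rfl
    · rw [glue_add, update_glue_add, update_load (by simp)]
      simp [load, encStr]
  have hlen (r : ℕ) : (s r).length ≤ L + E := by
    obtain ⟨k, hk, hrun⟩ := h
    have hload : (load [w, encNat d, encStr u] r).length ≤ w.length + d + u.length := by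
      rcases r with _ | _ | _ | r <;> simp +arith [load, encNat, encStr]
    linarith [hrun.length_le r]
  refine (hcount.seq (hload.seq ((h.frame hev _).seq
    (happend.seq (clearBelow_glue hlen _))))).mono ?_
  linarith

theorem generateStep_loop {h : Gen} (hN : 4 ≤ N) (hev : ev.numStacks ≤ N)
    (heval : ∀ u : Str, w.length + d + u.length ≤ L →
      ∃ s, Exec ev (load [w, encNat d, encStr u]) s E ∧ s 0 = [.bit (h u)])
    (hL : w.length + d + u.length + t ≤ L) :
    Exec (.loopUntil (N + 2) none (.generateStep ev N)) (generationStore N w d t u)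
      (generationStore N w d 0 (cot h t u))
      (t * (13 * L + 12 + E + N * (2 * (L + E) + 1)) + 1) := by
  induction t generalizing u with
  | zero => exact (loopDone (by rw [generationStore, glue_add]; rfl)).mono (Nat.le_add_left 1 _)
  | succ t ih =>
    obtain ⟨s, hrun, hs⟩ := heval u (by omega)
    have hcount : (generationStore N w d (t + 1) u (N + 2)).head? ≠ none := by
      rw [generationStore, glue_add]
      simp [load, encNat, List.replicate_succ]
    refine (loopStep hcount (generateStep hN hev hrun hs (Nat.le_of_add_right_le hL))
      (ih ?_)).mono ?_
    · rw [List.length_append, List.length_singleton]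
      omega
    · linarith

theorem generate {h : Gen} (hN : 4 ≤ N) (hev : ev.numStacks ≤ N)
    (heval : ∀ u : Str, w.length + d + u.length ≤ L →
      ∃ s, Exec ev (load [w, encNat d, encStr u]) s E ∧ s 0 = [.bit (h u)])
    {T : ℕ} (hT : 0 < T) {x : Str} (hL : w.length + d + x.length + T ≤ L) :
    ∃ s, Exec (.generate ev N) (load [w, encNat d, encNat T, encStr x]) s
      (T * (13 * L + 12 + E + N * (2 * (L + E) + 1)) + 5 * L + 8) ∧ s 0 = [.bit (e2e h T x)] := by
  obtain ⟨T, rfl⟩ := Nat.exists_eq_add_one.2 hT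
  have hsave := saveInputs hN w d (T + 1) x
  have hloop := generateStep_loop hN hev heval hL
  have htop : (generationStore N w d 0 (cot h (T + 1) x) (N + 3)).head? =
      some (.bit (e2e h (T + 1) x)) := by
    rw [generationStore, glue_add, e2e, cot_succ]
    simp [load, encStr]
  refine ⟨_, (hsave.seq (hloop.seq (pushTop htop))).mono (by omega), ?_⟩
  rw [Function.update_self, generationStore, glue_of_lt (by omega)]
  rfl

end Exec

theorem EvalInPolyTime.exists_predict {F : ℕ → Set Gen} {ρ : ℕ → List Symb → Gen}
    (hEval : EvalInPolyTime F ρ) :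
    ∃ (predict : Prog) (q : MvPolynomial (Fin 4) ℝ),
      ∀ (d : ℕ) (w : List Symb), ρ d w ∈ F d → ∀ (T : ℕ) (x : Str), 0 < T →
        predict.Outputs [w, encNat d, encNat T, encStr x] [.bit (e2e (ρ d w) T x)]
          (MvPolynomial.eval ![(w.length : ℝ), (d : ℝ), (T : ℝ), (x.length : ℝ)] q) := by
  obtain ⟨ev, p, hev⟩ := hEval
  let size : MvPolynomial (Fin 4) ℝ := .X 0 + .X 1 + .X 3 + .X 2
  obtain ⟨e, he⟩ := exists_abs_eval_le_eval p fun _ => size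
  obtain ⟨N, hN, hevN⟩ : ∃ N, 4 ≤ N ∧ ev.numStacks ≤ N := ⟨_, le_max_left _ _, le_max_right _ _⟩
  refine ⟨.generate ev N, .X 2 * (13 * size + 12 + e + N * (2 * (size + e) + 1)) + 5 * size + 8,
    fun d w hw T x hT => ?_⟩
  set L := w.length + d + x.length + T with hL
  set v : Fin 4 → ℝ := ![w.length, d, T, x.length] with hv
  have hT' : v 2 = T := rfl
  have hsize : MvPolynomial.eval v size = L := by simp [size, hv, hL]
  have he0 : 0 ≤ MvPolynomial.eval v e :=
    (abs_nonneg _).trans (he 0 v fun _ => by simp [hsize])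
  set E := ⌊MvPolynomial.eval v e⌋₊
  have heval (u : Str) (hu : w.length + d + u.length ≤ L) :
      ∃ s, Exec ev (load [w, encNat d, encStr u]) s E ∧ s 0 = [.bit (ρ d w u)] := by
    obtain ⟨t, s, hrun, hs, ht⟩ := hev d w hw u
    refine ⟨s, ⟨t, Nat.le_floor (ht.trans ((le_abs_self _).trans (he _ v ?_))), hrun⟩, hs⟩
    have hargs : (w.length : ℝ) ≤ L ∧ (d : ℝ) ≤ L ∧ (u.length : ℝ) ≤ L := by
      norm_cast
      omega
    simpa [Fin.forall_fin_succ, hsize] using hargs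
  obtain ⟨s, hrun, hs⟩ := Exec.generate hN hevN heval hT hL.ge
  refine hrun.outputs hs ?_
  calc _ = (T : ℝ) * (13 * L + 12 + E + N * (2 * (L + E) + 1)) + 5 * L + 8 := by push_cast; rfl
    _ ≤ T * (13 * L + 12 + MvPolynomial.eval v e + N * (2 * (L + MvPolynomial.eval v e) + 1)) +
        5 * L + 8 := by gcongr <;> exact Nat.floor_le he0
    _ = _ := by simp [hsize, hT']

/-! ### Polynomial bounds for training and prediction -/

theorem exists_bound_le_bound (p q : MvPolynomial (Fin 5) ℝ) : ∃ r : MvPolynomial (Fin 5) ℝ,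
    ∀ (n d T : ℕ) (ε δ : ℝ), 0 < ε → 0 < δ → δ < 1 →
      bound p n d T ε δ ≤ bound r n d T ε δ ∧ bound q n d T ε δ ≤ bound r n d T ε δ := by
  obtain ⟨p', hp⟩ := exists_abs_eval_le_eval p .X
  obtain ⟨q', hq⟩ := exists_abs_eval_le_eval q .X
  refine ⟨p' + q', fun n d T ε δ hε hδ hδ1 => ?_⟩
  have hlog : 0 ≤ Real.log (1 / δ) := Real.log_nonneg (one_le_one_div hδ hδ1.le)
  set v := ![(n : ℝ), d, T, 1 / ε, Real.log (1 / δ)] with hv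
  have hv0 : ∀ i, 0 ≤ v i := by
    simpa [Fin.forall_fin_succ, hv, -one_div] using ⟨(one_div_pos.2 hε).le, hlog⟩
  have hnonneg (i : Fin 5) : |v i| ≤ MvPolynomial.eval v (.X i) := by
    rw [MvPolynomial.eval_X, abs_of_nonneg]
    exact hv0 i
  have hp' := abs_le.1 (hp v v hnonneg)
  have hq' := abs_le.1 (hq v v hnonneg)
  simp only [bound, map_add]
  constructor <;> linarith

theorem length_encStrs_cotSample_le (f : Gen) (T : ℕ) {n : ℕ} {xs : List Str}
    (hxs : ∀ x ∈ xs, x.length ≤ n) :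
    (encStrs (cotSample f T xs)).length ≤ xs.length * (n + T + 1) := by
  induction xs with
  | nil => simp [cotSample, encStrs]
  | cons x xs ih =>
    obtain ⟨hx, hxs⟩ := List.forall_mem_cons.1 hxs
    rw [cotSample, List.map_cons, length_encStrs_cons, length_cot, List.length_cons, ← cotSample]
    linarith [ih hxs]

theorem ConsInPolyTime.exists_train_le_bound {F : ℕ → Set Gen} {ρ : ℕ → List Symb → Gen}
    (hCons : ConsInPolyTime F ρ) (r : MvPolynomial (Fin 5) ℝ) :
    ∃ (train : Prog) (A : ℕ → ℕ → List Str → List Symb) (p l : MvPolynomial (Fin 5) ℝ),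
      ∀ d T : ℕ, ∀ f ∈ F d, ∀ xs : List Str,
        ρ d (A d T (cotSample f T xs)) ∈ F d ∧
        cotSample (ρ d (A d T (cotSample f T xs))) T xs = cotSample f T xs ∧
        ∀ (n : ℕ) (ε δ : ℝ), (∀ x ∈ xs, x.length ≤ n) → xs.length ≤ bound r n d T ε δ →
          train.Outputs [encStrs (cotSample f T xs), encNat d, encNat T]
            (A d T (cotSample f T xs)) (bound p n d T ε δ) ∧
          (A d T (cotSample f T xs)).length ≤ bound l n d T ε δ := by
  obtain ⟨train, A, q, htrain⟩ := hCons.exists_train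
  let ℓ : MvPolynomial (Fin 5) ℝ := r * (.X 0 + .X 2 + 1)
  obtain ⟨p, hp⟩ := exists_abs_eval_le_eval q ![ℓ, .X 1, .X 2]
  refine ⟨train, A, p, ℓ + p, fun d T f hf xs => ?_⟩
  obtain ⟨hproper, hfit, hrun⟩ :=
    htrain d T (cotSample f T xs) ⟨f, hf, forall_mem_nextTokenSample_iff.2 rfl⟩
  refine ⟨hproper, forall_mem_nextTokenSample_iff.1 hfit, fun n ε δ hxs hm => ?_⟩
  have hlen : ((encStrs (cotSample f T xs)).length : ℝ) ≤ bound ℓ n d T ε δ :=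
    calc ((encStrs (cotSample f T xs)).length : ℝ)
        ≤ xs.length * (n + T + 1) := mod_cast length_encStrs_cotSample_le f T hxs
      _ ≤ bound r n d T ε δ * (n + T + 1) := by gcongr
      _ = bound ℓ n d T ε δ := by simp [bound, ℓ]
  have htime := (le_abs_self _).trans (hp ![((encStrs (cotSample f T xs)).length : ℝ), d, T]
    ![(n : ℝ), d, T, 1 / ε, Real.log (1 / δ)]
    (by simpa [Fin.forall_fin_succ, bound, -one_div] using hlen))
  have houtputs := (hrun (by simp [cotSample, length_cot])).mono htime
  refine ⟨houtputs, houtputs.length_le.trans ?_⟩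
  simpa [bound, -one_div] using hlen

theorem EvalInPolyTime.exists_predict_le_bound {F : ℕ → Set Gen} {ρ : ℕ → List Symb → Gen}
    (hEval : EvalInPolyTime F ρ) (l : MvPolynomial (Fin 5) ℝ) :
    ∃ (predict : Prog) (q : MvPolynomial (Fin 5) ℝ),
      ∀ (n d T : ℕ) (ε δ : ℝ) (w : List Symb) (x : Str), 0 < T → ρ d w ∈ F d →
        w.length ≤ bound l n d T ε δ → x.length ≤ n →
          predict.Outputs [w, encNat d, encNat T, encStr x] [.bit (e2e (ρ d w) T x)]
            (bound q n d T ε δ) := by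
  obtain ⟨predict, p, hpredict⟩ := hEval.exists_predict
  obtain ⟨q, hq⟩ := exists_abs_eval_le_eval p ![l, .X 1, .X 2, .X 0]
  refine ⟨predict, q, fun n d T ε δ w x hT hw hwlen hx => ?_⟩
  refine (hpredict d w hw T x hT).mono ((le_abs_self _).trans (hq _ _ ?_))
  simpa [Fin.forall_fin_succ, bound, -one_div] using ⟨hwlen, hx⟩

end CoTLearning

theorem mainTheorem8 (F : ℕ → Set Gen) (ρ : ℕ → List Symb → Gen)
    (hCons : ConsInPolyTime F ρ) (hVC : VCPolyBounded F) :
    CoTLearnableInPolyTime F ρ := by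
  obtain ⟨k, r, hk, hr⟩ := hVC.exists_sampleSize_le_bound
  obtain ⟨train, A, p, l, htrain⟩ := hCons.exists_train_le_bound r
  obtain ⟨s, hs⟩ := exists_bound_le_bound r p
  refine ⟨train, A, fun d T => sampleSize (k d) T, s, ?learns, ?sampleSize, ?train, ?predict⟩
  case learns =>
    exact fun d T _ X => .of_consistent (hk d) T X (fun S => ρ d (A d T S))
      fun f hf xs => (htrain d T f hf xs).imp_right And.left
  case sampleSize =>
    intro n d T ε δ _ hε _ hδ hδ1
    exact (hr n d T ε δ hε hδ hδ1).trans (hs n d T ε δ hε hδ hδ1).1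
  case train =>
    intro n d T ε δ _ hε _ hδ hδ1 f hf xs hm hxs
    obtain ⟨hproper, -, hrun⟩ := htrain d T f hf xs
    obtain ⟨houtputs, -⟩ := hrun n ε δ hxs (hm ▸ hr n d T ε δ hε hδ hδ1)
    exact ⟨hproper, houtputs.mono (hs n d T ε δ hε hδ hδ1).2⟩
  case predict =>
    intro hEval
    obtain ⟨predict, q, hpredict⟩ := hEval.exists_predict_le_bound l
    refine ⟨predict, q, fun n d T ε δ hT hε _ hδ hδ1 f hf xs hm hxs x hx => ?_⟩
    obtain ⟨hproper, -, hrun⟩ := htrain d T f hf xs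
    obtain ⟨-, hlen⟩ := hrun n ε δ hxs (hm ▸ hr n d T ε δ hε hδ hδ1)
    exact hpredict n d T ε δ _ x hT hproper hlen hx
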